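/- Let $d,\nu\ge 1$ and $m\ge 0$ be integers, and let $\Omega\subseteq[0,1]^d$ be a Lebesgue measurable set with $\mu_d(\Omega)>0$ and $\mu_d(\partial\Omega)=0$. Let $p$ be a real function on $\mathbb R^d$ (only its values on $[0,1]^d$ matter) such that $p|_\Omega$ is continuous at almost every point of $\Omega$. **Graphs.** Let $W\in\mathbb R^{\nu\times\nu}$ be symmetric with zero diagonal (the adjacency matrix of the mold graph $G$ on $[\nu]$), and let $\mathbf t_1,\dots,\mathbf t_m\in\mathbb Z_{\ge 0}^d\setminus\{\mathbf 0\}$ be strictly increasing in lexicographic order. A *direction* of $\mathbf t_k$ is a vector $\alpha=(\pm(t_k)_1,\dots,\pm(t_k)_d)$ whose first nonzero component is positive; write $[\mathbf t_k]^+$ for the set of these. For every $k$ and $\alpha\in[\mathbf t_k]^+$ let $L_{k,\alpha}\in\mathbb R^{\nu\times\nu}$. For $\mathbf n=(n_1,\dots,n_d)\in\mathbb N^d$, the $d$-level diamond Toeplitz graph has nodes $(\mathbf i,r)$, $1\le i_q\le n_q$, $1\le r\le\nu$, and symmetric weights $w_{\mathbf n}((\mathbf i,r),(\mathbf j,s))=(\mathbf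 w_{\mathbf i-\mathbf j})_{r,s}$, where $\mathbf w_{\mathbf 0}=W$, $\mathbf w_{\alpha}=L_{k,\alpha}$ and $\mathbf w_{-\alpha}=L_{k,\alpha}^T$ for $\alpha\in[\mathbf t_k]^+$, and $\mathbf w_\delta=0$ for all other $\delta\in\mathbb Z^d$. Its nodes are placed in $(0,1)^d$ at $$\mathbf x_{(\mathbf i,r)}=\Big(\tfrac{(i_1-1)\nu+r}{\nu n_1+1},\tfrac{i_2}{n_2+1},\dots,\tfrac{i_d}{n_d+1}\Big).$$ The diamond Toeplitz grid graph in $\Omega$ has as nodes those $u=(\mathbf i,r)$ with $\mathbf x_u\in\Omega$, and weights $p\big(\tfrac{\mathbf x_u+\mathbf x_v}{2}\big)\,w_{\mathbf n}(u,v)$. Let $W_{\mathbf n}$ be its adjacency matrix, $D_{\mathbf n}$ the diagonal matrix of the degrees $\deg(u)=\sum_v (W_{\mathbf n})_{u,v}$, and, given a potential $\kappa_{\mathbf n}\ge 0$ on its nodes, $K_{\mathbf n}=\mathrm{diag}(\kappa_{\mathbf n})$ and $\Delta_{\mathbf n}=D_{\mathbf n}+K_{\mathbf n}-W_{\mathbf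 n}$ the graph-Laplacian, a symmetric matrix of order $d_{\mathbf n}$, the number of nodes in $\Omega$. **Symbol.** For $\boldsymbol\theta\in[-\pi,\pi]^d$ put $$\mathbf f(\boldsymbol\theta)=W+\sum_{k=1}^m\sum_{\alpha\in[\mathbf t_k]^+}\Big[(L_{k,\alpha}+L_{k,\alpha}^T)\cos(\alpha\cdot\boldsymbol\theta)+(L_{k,\alpha}-L_{k,\alpha}^T)\,\mathrm i\sin(\alpha\cdot\boldsymbol\theta)\Big]\in\mathbb C^{\nu\times\nu}.$$ **Statement.** Let $\mathbf n\to\infty$ mean $\min_q n_q\to\infty$, along all multi-indices or along any given family of them. Let $c\in\mathbb R$, with $\Omega,p,m,W,\mathbf t_k,L_{k,\alpha},c$ independent of $\mathbf n$, and suppose that $$D_{\mathbf n}+K_{\mathbf n}=c\,I\cdot\mathrm{diag}\big(p(\mathbf x_{(\mathbf i,r)})\big)+o(1),$$ that is, $\max_u|\deg(u)+\kappa_{\mathbf n}(u)-c\,p(\mathbf x_u)|\to 0$ as $\mathbf n\to\infty$. Then $\{\Delta_{\mathbf n}\}\sim_\lambda \mathbf g$ with $\mathbf g(\mathbf x,\boldsymbol\theta)=p(\mathbf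 x)\,(cI-\mathbf f(\boldsymbol\theta))$ on $D=\Omega\times[-\pi,\pi]^d$. That is: $0<\mu_{2d}(D)<\infty$, $\mathbf g$ is measurable and Hermitian-valued on $D$, $d_{\mathbf n}\to\infty$, and for every continuous $F:\mathbb C\to\mathbb C$ with compact support $$\lim_{\mathbf n\to\infty}\frac1{d_{\mathbf n}}\sum_{k=1}^{d_{\mathbf n}}F\big(\lambda_k(\Delta_{\mathbf n})\big)=\frac1{\mu_{2d}(D)}\int_D\frac1\nu\sum_{k=1}^{\nu}F\big(\lambda_k(\mathbf g(\mathbf x,\boldsymbol\theta))\big)\,d\mathbf x\,d\boldsymbol\theta .$$ -/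

import Mathlib

open MeasureTheory Filter Topology

/-! ## Weighted undirected graphs and their Laplacians -/

/-- An undirected weighted graph without self-loops on the node set `V`; the edges are the pairs
with `w u v ≠ 0`. The potential term is carried separately. -/
structure WeightedGraph (V : Type*) where
  w : V → V → ℝ
  symm : ∀ u v, w u v = w v u
  loopless : ∀ v, w v v = 0

namespace WeightedGraph

variable {V : Type*}

/-- The adjacency matrix `W`. -/
def adjMatrix (G : WeightedGraph V) : Matrix V V ℝ := Matrix.of G.w

/-- The degree of a node: the sum of the weights of the edges incident to it (the pairs that are
not edges have weight `0` and contribute nothing). -/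
def deg [Fintype V] (G : WeightedGraph V) (v : V) : ℝ := ∑ u, G.w v u

/-- The degree matrix `D`. -/
def degMatrix [Fintype V] [DecidableEq V] (G : WeightedGraph V) : Matrix V V ℝ :=
  Matrix.diagonal G.deg

/-- The graph-Laplacian `D + K - W` of the graph `G` with potential term `κ`, `K = diag κ`. -/
def laplacian [Fintype V] [DecidableEq V] (G : WeightedGraph V) (κ : V → ℝ) : Matrix V V ℝ :=
  G.degMatrix + Matrix.diagonal κ - G.adjMatrix

/-- The graph obtained by restricting the weight function to the nodes satisfying `P`. -/
def restrict (G : WeightedGraph V) (P : V → Prop) : WeightedGraph {v // P v} where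
  w u v := G.w u.1 v.1
  symm u v := G.symm u.1 v.1
  loopless v := G.loopless v.1

end WeightedGraph

/-! ## Diamond Toeplitz graphs -/

/-- The directions of a `d`-index `t ≥ 0`: the vectors `(± t₁, …, ± t_d)` whose first nonzero
component is positive, i.e. the positive representatives of the classes `{δ, -δ}`. -/
def directions {d : ℕ} (t : Fin d → ℕ) : Finset (Fin d → ℤ) :=
  (Fintype.piFinset fun r => ({(t r : ℤ), -(t r : ℤ)} : Finset ℤ)).filter
    fun δ => ∃ r, (∀ s, s < r → δ s = 0) ∧ 0 < δ r

/-- The data, independent of the size `n`, of a `d`-level diamond Toeplitz graph: the mold graph on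
`ν` nodes, the `d`-indices `0 ◁ t₁ ◁ … ◁ t_m` in lexicographic order, and one linking-graph operator
for each direction of each `t_k`. A zero operator is allowed: it means that there is no link in that
direction. -/
structure DiamondData (d m ν : ℕ) where
  mold : WeightedGraph (Fin ν)
  t : Fin m → Fin d → ℕ
  t_ne_zero : ∀ k, t k ≠ 0
  t_strictMono : StrictMono fun k => toLex (t k)
  L : ∀ k, directions (t k) → Matrix (Fin ν) (Fin ν) ℝ

/-- The nodes `(j, r)` of a diamond Toeplitz graph of size `n`: `j` is the (0-based) multi-index of
the diamond and `r` the (0-based) index inside the diamond. -/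
abbrev DiamondNode {d : ℕ} (n : Fin d → ℕ) (ν : ℕ) : Type := (∀ r, Fin (n r)) × Fin ν

/-- The difference `i - j ∈ ℤ^d` of two multi-indices. -/
def indexDiff {d : ℕ} {n : Fin d → ℕ} (i j : ∀ r, Fin (n r)) : Fin d → ℤ :=
  fun r => ((i r : ℕ) : ℤ) - ((j r : ℕ) : ℤ)

namespace DiamondData

variable {d m ν : ℕ}

/-- The block linking diamonds `i` and `j` with `i - j = δ`: the adjacency matrix of the mold graph
if `δ = 0`, the linking operator `L_α` if `δ` is a direction `α` of some `t_k`, its transpose if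
`-δ` is, and `0` otherwise. (The directions of all the `t_k` and their opposites are distinct, so at
most one summand is nonzero; see `block_direction`, `block_neg_direction`.) -/
def block (T : DiamondData d m ν) (δ : Fin d → ℤ) : Matrix (Fin ν) (Fin ν) ℝ :=
  if δ = 0 then T.mold.adjMatrix
  else ∑ k, ∑ α : directions (T.t k),
    ((if δ = α.1 then T.L k α else 0) + (if δ = -α.1 then (T.L k α).transpose else 0))

theorem block_neg (T : DiamondData d m ν) (δ : Fin d → ℤ) :
    T.block (-δ) = (T.block δ).transpose := by
  unfold block
  by_cases h : δ = 0
  · subst h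
    ext r s
    simp [WeightedGraph.adjMatrix, T.mold.symm r s]
  · rw [if_neg (by simpa using h), if_neg h]
    simp only [Matrix.transpose_sum]
    refine Finset.sum_congr rfl fun k _ => Finset.sum_congr rfl fun α _ => ?_
    rw [Matrix.transpose_add, add_comm]
    congr 1
    · by_cases h1 : δ = α.1
      · simp [h1]
      · simp [h1]
    · by_cases h1 : δ = -α.1
      · simp [h1]
      · have h2 : ¬ -δ = α.1 := fun h3 => h1 (by rw [← h3, neg_neg])
        simp [h1, h2]

theorem natAbs_of_mem_directions {t : Fin d → ℕ} {δ : Fin d → ℤ} (h : δ ∈ directions t) :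
    (fun r => (δ r).natAbs) = t := by
  simp only [directions, Finset.mem_filter, Fintype.mem_piFinset, Finset.mem_insert,
    Finset.mem_singleton] at h
  funext r
  rcases h.1 r with h1 | h1 <;> simp [h1]

theorem ne_zero_of_mem_directions {t : Fin d → ℕ} {δ : Fin d → ℤ} (h : δ ∈ directions t) :
    δ ≠ 0 := by
  rintro rfl
  simp [directions] at h

theorem neg_ne_of_mem_directions {t t' : Fin d → ℕ} {δ δ' : Fin d → ℤ} (h : δ ∈ directions t)
    (h' : δ' ∈ directions t') : δ ≠ -δ' := by
  simp only [directions, Finset.mem_filter] at h h'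
  obtain ⟨_, r, hr, hr0⟩ := h
  obtain ⟨_, s, hs, hs0⟩ := h'
  intro he
  have e1 : δ r = -δ' r := congrFun he r
  have e2 : δ s = -δ' s := congrFun he s
  rcases lt_trichotomy r s with h | h | h
  · have := hs r h
    omega
  · subst h
    omega
  · have := hr s h
    omega

/-- In the direction `α` of `t_k` the link is `L_α`. -/
theorem block_direction (T : DiamondData d m ν) (k : Fin m) (α : directions (T.t k)) :
    T.block α.1 = T.L k α := by
  unfold block
  rw [if_neg (ne_zero_of_mem_directions α.2), Finset.sum_eq_single k,
    Finset.sum_eq_single α]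
  · rw [if_pos rfl, if_neg (neg_ne_of_mem_directions α.2 α.2), add_zero]
  · intro β _ hβ
    rw [if_neg (fun h => hβ (Subtype.ext h.symm)), if_neg (neg_ne_of_mem_directions α.2 β.2),
      add_zero]
  · simp
  · intro k' _ hk'
    refine Finset.sum_eq_zero fun β _ => ?_
    rw [if_neg, if_neg (neg_ne_of_mem_directions α.2 β.2), add_zero]
    intro h
    refine hk' (T.t_strictMono.injective ?_)
    have h1 := natAbs_of_mem_directions α.2
    have h2 := natAbs_of_mem_directions β.2
    rw [h] at h1
    exact congrArg toLex (h2.symm.trans h1)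
  · simp

/-- In the opposite direction the link is the transpose of `L_α`. -/
theorem block_neg_direction (T : DiamondData d m ν) (k : Fin m) (α : directions (T.t k)) :
    T.block (-α.1) = (T.L k α).transpose := by
  rw [block_neg, block_direction]

/-- The `d`-level diamond Toeplitz graph of size `n`. -/
def toeplitzGraph (T : DiamondData d m ν) (n : Fin d → ℕ) : WeightedGraph (DiamondNode n ν) where
  w u v := T.block (indexDiff u.1 v.1) u.2 v.2
  symm u v := by
    have h : indexDiff v.1 u.1 = -indexDiff u.1 v.1 := by
      funext r
      simp [indexDiff]
    rw [h, block_neg, Matrix.transpose_apply]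
  loopless v := by
    have h : indexDiff v.1 v.1 = 0 := by
      funext r
      simp [indexDiff]
    rw [h]
    simp [block, WeightedGraph.adjMatrix, T.mold.loopless]

/-- The symbol `f(θ)` of the diamond Toeplitz graphs:
`W + ∑_k ∑_α ((L_α + L_αᵀ) cos(α · θ) + (L_α - L_αᵀ) i sin(α · θ))`, where `α` runs over the
directions of `t_k`. -/
noncomputable def symbol (T : DiamondData d m ν) (θ : Fin d → ℝ) : Matrix (Fin ν) (Fin ν) ℂ :=
  T.mold.adjMatrix.map Complex.ofReal +
    ∑ k, ∑ α : directions (T.t k),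
      (((Real.cos (∑ r, (α.1 r : ℝ) * θ r) : ℝ) : ℂ) •
          (T.L k α + (T.L k α).transpose).map Complex.ofReal +
        (Complex.I * ((Real.sin (∑ r, (α.1 r : ℝ) * θ r) : ℝ) : ℂ)) •
          (T.L k α - (T.L k α).transpose).map Complex.ofReal)

end DiamondData

/-! ## Immersion in a regular domain -/

/-- A regular domain of `[0,1]^d`: a Lebesgue measurable subset of positive measure whose boundary
has measure zero. -/
structure IsRegularDomain {d : ℕ} (Ω : Set (Fin d → ℝ)) : Prop where
  subset_cube : Ω ⊆ Set.Icc 0 1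
  nullMeasurable : NullMeasurableSet Ω volume
  volume_pos : 0 < volume Ω
  volume_frontier : volume (frontier Ω) = 0

/-- The immersion of the nodes in the open cube. The nodes of the diamonds are lined up along the
first axis: with 1-based indices, `(j, r)` goes to
`(((j₁ - 1) ν + r) h₁, j₂ h₂, …, j_d h_d)`, `h₁ = 1 / (ν n₁ + 1)`, `h_q = 1 / (n_q + 1)`. -/
noncomputable def immersion {d ν : ℕ} [NeZero d] (n : Fin d → ℕ) (v : DiamondNode n ν) :
    Fin d → ℝ := fun q =>
  if q = 0 then (((v.1 q : ℕ) : ℝ) * ν + ((v.2 : ℕ) : ℝ) + 1) / ((ν : ℝ) * n q + 1)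
  else (((v.1 q : ℕ) : ℝ) + 1) / ((n q : ℝ) + 1)

/-- The nodes of the grid that lie in `Ω`. -/
abbrev GridNode {d : ℕ} [NeZero d] (Ω : Set (Fin d → ℝ)) (n : Fin d → ℕ) (ν : ℕ) : Type :=
  {v : DiamondNode n ν // immersion n v ∈ Ω}

noncomputable instance instFintypeGridNode {d : ℕ} [NeZero d] (Ω : Set (Fin d → ℝ))
    (n : Fin d → ℕ) (ν : ℕ) : Fintype (GridNode Ω n ν) := Fintype.ofFinite _

namespace DiamondData

variable {d m ν : ℕ} [NeZero d]

/-- The `d`-level diamond Toeplitz grid graph in the cube: the weight of the diamond Toeplitz graph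
multiplied by the value of `p` at the midpoint of the two nodes. -/
noncomputable def cubeGraph (T : DiamondData d m ν) (p : (Fin d → ℝ) → ℝ) (n : Fin d → ℕ) :
    WeightedGraph (DiamondNode n ν) where
  w u v := p ((1 / 2 : ℝ) • (immersion n u + immersion n v)) * (T.toeplitzGraph n).w u v
  symm u v := by rw [add_comm, (T.toeplitzGraph n).symm u v]
  loopless v := by rw [(T.toeplitzGraph n).loopless v, mul_zero]

/-- The `d`-level diamond Toeplitz grid graph in `Ω`. -/
noncomputable def gridGraph (T : DiamondData d m ν) (Ω : Set (Fin d → ℝ)) (p : (Fin d → ℝ) → ℝ)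
    (n : Fin d → ℕ) : WeightedGraph (GridNode Ω n ν) :=
  (T.cubeGraph p n).restrict fun v => immersion n v ∈ Ω

end DiamondData

/-! ## Eigenvalue distribution -/

/-- `∑ F(λ)` over the eigenvalues `λ` of `A`, with algebraic multiplicity. -/
noncomputable def eigSum {N : Type*} [Fintype N] [DecidableEq N] (F : ℂ → ℂ) (A : Matrix N N ℂ) :
    ℂ := (A.charpoly.roots.map F).sum

/-- The matrices `X a`, as `a` runs along the filter `l`, have sizes tending to infinity and are
distributed in the sense of the eigenvalues like the measurable Hermitian matrix-valued function `g`
on `D`, `0 < μ(D) < ∞`: for every continuous `F` with compact support, the mean of `F` over the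
eigenvalues of `X a` tends to the mean of `F` over the `ν` eigenvalues of `g(y)`, `y ∈ D`. -/
structure IsEigDistributed {ι : Type*} (l : Filter ι) {N : ι → Type*} [∀ a, Fintype (N a)]
    [∀ a, DecidableEq (N a)] (X : ∀ a, Matrix (N a) (N a) ℂ) {E : Type*} [MeasureSpace E] {ν : ℕ}
    (D : Set E) (g : E → Matrix (Fin ν) (Fin ν) ℂ) : Prop where
  card_tendsto : Tendsto (fun a => Fintype.card (N a)) l atTop
  nullMeasurable : NullMeasurableSet D volume
  volume_pos : 0 < volume D
  volume_lt_top : volume D < ⊤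
  aemeasurable : ∀ i j, AEMeasurable (fun y => g y i j) (volume.restrict D)
  hermitian : ∀ y ∈ D, (g y).IsHermitian
  tendsto : ∀ F : ℂ → ℂ, Continuous F → HasCompactSupport F →
    Tendsto (fun a => (1 / (Fintype.card (N a) : ℂ)) * eigSum F (X a)) l
      (𝓝 ((1 / (volume.real D : ℂ)) * ∫ y in D, (1 / (ν : ℂ)) * eigSum F (g y)))

/-! Up to a diagonal matrix with uniformly small entries, the graph-Laplacian is the block Toeplitz
matrix with symbol `c - f`, restricted to the nodes in `Ω`, each entry multiplied by the value of
`p` at the midpoint of its two nodes (`DiamondData.laplacian_eq_midSampled`).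

Suppose first that the weight is a continuous `φ` with compact support inside `interior Ω`. A row
whose node lies in the support has all its neighbours in `Ω`, so truncation to `Ω` is invisible; and
`φ` hardly changes over the bounded range of the links. Hence the `k`-th power of the matrix is, up
to small row sums, the Toeplitz matrix of `b ^ k` weighted by `φ ^ k` (`eventually_rowSumLE_pow`).
Its normalised trace is a Riemann sum, which tends to the `k`-th moment of `φ(x) b(θ)`. The spectra
are uniformly bounded, so Weierstrass approximation passes from moments to continuous test functions
(`tendsto_mean_eigSum_midSampled`).

A general `p` may be unbounded and is only almost everywhere continuous. It is replaced by such a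
`φ`, equal to `p` on a compact `K` of almost full measure and uniformly close to it near `K`. The
resulting change of the matrix has small row sums, except on the block of the few nodes far from
`K`. That block has no size bound but small rank (`norm_eigSum_midSampled_sub_le`).

Both kinds of perturbation are controlled by one inequality. The squared inner products of the two
eigenbases form a doubly stochastic matrix, and averaging against it compares eigenvalue sums with
`‖w(A) - w(B)‖²` in Frobenius norm (`norm_eigSum_sub_le`). Small row sums are treated with `w = id`,
small rank with `w` the resolvent, which is bounded whatever the size of the perturbation. -/

namespace Matrix

/-! ### Comparison of eigenvalue sums of two Hermitian matrices -/

variable {N : Type*} [Fintype N] {A B : Matrix N N ℂ}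

/-- The square of the Frobenius norm. -/
noncomputable def frobSq (X : Matrix N N ℂ) : ℝ := ∑ i, ∑ j, ‖X i j‖ ^ 2

theorem trace_conjTranspose_mul_self (X : Matrix N N ℂ) : (Xᴴ * X).trace = (X.frobSq : ℂ) := by
  simp only [trace, diag_apply, mul_apply, conjTranspose_apply, frobSq, RCLike.star_def,
    Complex.conj_mul']
  rw [Finset.sum_comm]
  push_cast
  rfl

variable [DecidableEq N]

/-- The two unitaries may differ because the eigenbases of two matrices will stand on the two sides.
-/
theorem frobSq_unitary_mul_mul (U V : unitaryGroup N ℂ) (X : Matrix N N ℂ) :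
    (star (U : Matrix N N ℂ) * X * (V : Matrix N N ℂ)).frobSq = X.frobSq := by
  have hU : (U : Matrix N N ℂ) * star (U : Matrix N N ℂ) = 1 := Unitary.mul_star_self_of_mem U.2
  have hV : (V : Matrix N N ℂ) * star (V : Matrix N N ℂ) = 1 := Unitary.mul_star_self_of_mem V.2
  rw [star_eq_conjTranspose] at hU hV
  have h : ((star (U : Matrix N N ℂ) * X * (V : Matrix N N ℂ)).frobSq : ℂ) = X.frobSq := by
    rw [← trace_conjTranspose_mul_self, ← trace_conjTranspose_mul_self, star_eq_conjTranspose,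
      conjTranspose_mul, conjTranspose_mul, conjTranspose_conjTranspose,
      trace_mul_comm, ← trace_mul_comm X]
    calc _ = trace ((U : Matrix N N ℂ)ᴴ * X * ((V : Matrix N N ℂ) * (V : Matrix N N ℂ)ᴴ) * Xᴴ *
          (U : Matrix N N ℂ)) := by simp only [Matrix.mul_assoc]
      _ = trace ((U : Matrix N N ℂ) * (U : Matrix N N ℂ)ᴴ * X * Xᴴ) := by
          rw [hV, Matrix.mul_one, trace_mul_comm]; simp only [Matrix.mul_assoc]
      _ = _ := by rw [hU, Matrix.one_mul]
  exact_mod_cast h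

theorem sum_norm_sq_row_of_unitary (Q : unitaryGroup N ℂ) (i : N) :
    ∑ j, ‖(Q : Matrix N N ℂ) i j‖ ^ 2 = 1 := by
  have h0 : (Q : Matrix N N ℂ) * star (Q : Matrix N N ℂ) = 1 := Unitary.mul_star_self_of_mem Q.2
  have h := congrFun (congrFun h0 i) i
  simp only [star_eq_conjTranspose, mul_apply, conjTranspose_apply, RCLike.star_def,
    Complex.mul_conj', one_apply_eq] at h
  exact_mod_cast h

theorem sum_norm_sq_col_of_unitary (Q : unitaryGroup N ℂ) (j : N) :
    ∑ i, ‖(Q : Matrix N N ℂ) i j‖ ^ 2 = 1 := by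
  have h0 : star (Q : Matrix N N ℂ) * (Q : Matrix N N ℂ) = 1 := Unitary.star_mul_self_of_mem Q.2
  have h := congrFun (congrFun h0 j) j
  simp only [star_eq_conjTranspose, mul_apply, conjTranspose_apply, RCLike.star_def,
    Complex.conj_mul', one_apply_eq] at h
  exact_mod_cast h

namespace IsHermitian

/-- The functional calculus of a Hermitian matrix. -/
noncomputable def applyFun (hA : A.IsHermitian) (w : ℝ → ℂ) : Matrix N N ℂ :=
  (hA.eigenvectorUnitary : Matrix N N ℂ) * diagonal (fun i => w (hA.eigenvalues i)) *
    star (hA.eigenvectorUnitary : Matrix N N ℂ)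

theorem applyFun_ofReal (hA : A.IsHermitian) : hA.applyFun (fun x => (x : ℂ)) = A := by
  conv_rhs => rw [hA.spectral_theorem, Unitary.conjStarAlgAut_apply]
  rfl

theorem applyFun_one (hA : A.IsHermitian) : hA.applyFun (fun _ => 1) = 1 := by
  have hU := Unitary.mul_star_self_of_mem hA.eigenvectorUnitary.2
  simp only [applyFun, diagonal_one, Matrix.mul_one]
  exact hU

theorem applyFun_mul (hA : A.IsHermitian) (v w : ℝ → ℂ) :
    hA.applyFun v * hA.applyFun w = hA.applyFun (fun x => v x * w x) := by
  have hU : star (hA.eigenvectorUnitary : Matrix N N ℂ) * (hA.eigenvectorUnitary : Matrix N N ℂ) = 1 :=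
    Unitary.star_mul_self_of_mem hA.eigenvectorUnitary.2
  simp only [applyFun]
  calc _ = (hA.eigenvectorUnitary : Matrix N N ℂ) * diagonal (fun i => v (hA.eigenvalues i)) *
        (star (hA.eigenvectorUnitary : Matrix N N ℂ) * (hA.eigenvectorUnitary : Matrix N N ℂ)) *
        diagonal (fun i => w (hA.eigenvalues i)) * star (hA.eigenvectorUnitary : Matrix N N ℂ) := by
        simp only [Matrix.mul_assoc]
    _ = _ := by
      rw [hU, Matrix.mul_one, Matrix.mul_assoc (hA.eigenvectorUnitary : Matrix N N ℂ) (diagonal _),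
        diagonal_mul_diagonal]

theorem applyFun_add (hA : A.IsHermitian) (v w : ℝ → ℂ) :
    hA.applyFun v + hA.applyFun w = hA.applyFun (fun x => v x + w x) := by
  simp only [applyFun, ← Matrix.add_mul, ← Matrix.mul_add, diagonal_add]

theorem trace_applyFun (hA : A.IsHermitian) (w : ℝ → ℂ) :
    (hA.applyFun w).trace = ∑ i, w (hA.eigenvalues i) := by
  have hU : star (hA.eigenvectorUnitary : Matrix N N ℂ) * (hA.eigenvectorUnitary : Matrix N N ℂ) = 1 :=
    Unitary.star_mul_self_of_mem hA.eigenvectorUnitary.2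
  rw [applyFun, trace_mul_comm, ← Matrix.mul_assoc, hU, Matrix.one_mul, trace_diagonal]

theorem pow_eq_applyFun (hA : A.IsHermitian) (k : ℕ) :
    A ^ k = hA.applyFun (fun x => (x : ℂ) ^ k) := by
  induction k with
  | zero => simp [applyFun_one]
  | succ k ih =>
    rw [pow_succ, ih]
    nth_rewrite 2 [← hA.applyFun_ofReal]
    rw [applyFun_mul]
    simp only [pow_succ]

theorem trace_pow (hA : A.IsHermitian) (k : ℕ) :
    (A ^ k).trace = ∑ i, (hA.eigenvalues i : ℂ) ^ k := by
  rw [hA.pow_eq_applyFun, trace_applyFun]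

theorem eigSum_eq (hA : A.IsHermitian) (F : ℂ → ℂ) :
    eigSum F A = ∑ i, F (hA.eigenvalues i) := by
  rw [eigSum, hA.roots_charpoly_eq_eigenvalues, Multiset.map_map]
  rfl

/-- The weights `|⟨u_i, v_j⟩|²` of the eigenvectors of two Hermitian matrices. -/
noncomputable def overlap (hA : A.IsHermitian) (hB : B.IsHermitian) (i j : N) : ℝ :=
  ‖((star hA.eigenvectorUnitary * hB.eigenvectorUnitary : unitaryGroup N ℂ) : Matrix N N ℂ) i j‖ ^ 2

/-- With `U`, `V` the eigenvector unitaries, the `(i, j)` entry of `U* (w(A) - w(B)) V` is `(w(λ_i)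
- w(μ_j)) (U* V)_{ij}`, and the Frobenius norm is unitarily invariant. -/
theorem sum_overlap_mul_norm_sub_sq (hA : A.IsHermitian) (hB : B.IsHermitian) (w : ℝ → ℂ) :
    ∑ i, ∑ j, hA.overlap hB i j * ‖w (hA.eigenvalues i) - w (hB.eigenvalues j)‖ ^ 2 =
      (hA.applyFun w - hB.applyFun w).frobSq := by
  rw [← frobSq_unitary_mul_mul hA.eigenvectorUnitary hB.eigenvectorUnitary]
  have hU : star (hA.eigenvectorUnitary : Matrix N N ℂ) * (hA.eigenvectorUnitary : Matrix N N ℂ) = 1 :=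
    Unitary.star_mul_self_of_mem hA.eigenvectorUnitary.2
  have hV : star (hB.eigenvectorUnitary : Matrix N N ℂ) * (hB.eigenvectorUnitary : Matrix N N ℂ) = 1 :=
    Unitary.star_mul_self_of_mem hB.eigenvectorUnitary.2
  have h1 : star (hA.eigenvectorUnitary : Matrix N N ℂ) * (hA.applyFun w - hB.applyFun w) *
      (hB.eigenvectorUnitary : Matrix N N ℂ) =
      diagonal (fun i => w (hA.eigenvalues i)) *
        (star (hA.eigenvectorUnitary : Matrix N N ℂ) * (hB.eigenvectorUnitary : Matrix N N ℂ)) -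
      (star (hA.eigenvectorUnitary : Matrix N N ℂ) * (hB.eigenvectorUnitary : Matrix N N ℂ)) *
        diagonal (fun i => w (hB.eigenvalues i)) := by
    rw [Matrix.mul_sub, Matrix.sub_mul, applyFun, applyFun]
    congr 1
    · simp only [← Matrix.mul_assoc, hU, Matrix.one_mul]
    · simp only [Matrix.mul_assoc, hV, Matrix.mul_one]
  rw [h1, frobSq]
  refine Finset.sum_congr rfl fun i _ => Finset.sum_congr rfl fun j _ => ?_
  rw [sub_apply, diagonal_mul, mul_diagonal, mul_comm _ (w (hB.eigenvalues j)), ← sub_mul, norm_mul,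
    mul_pow, mul_comm]
  rfl

/-- Eigenvalue sums of two Hermitian matrices are close when a function of the matrices that
controls `F` is close in Frobenius norm. -/
theorem norm_eigSum_sub_le (hA : A.IsHermitian) (hB : B.IsHermitian) (w : ℝ → ℂ) (F : ℂ → ℂ)
    {ε C : ℝ} (hF : ∀ x y : ℝ, ‖F x - F y‖ ≤ ε + C * ‖w x - w y‖ ^ 2) :
    ‖eigSum F A - eigSum F B‖ ≤
      ε * Fintype.card N + C * (hA.applyFun w - hB.applyFun w).frobSq := by
  have hrow : ∀ i, ∑ j, hA.overlap hB i j = 1 := fun i => sum_norm_sq_row_of_unitary _ i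
  have hcol : ∀ j, ∑ i, hA.overlap hB i j = 1 := fun j => sum_norm_sq_col_of_unitary _ j
  -- The overlaps are doubly stochastic, so each single sum over eigenvalues can be spread over all
  -- pairs `(i, j)`.
  have h1 : eigSum F A - eigSum F B =
      ∑ i, ∑ j, (hA.overlap hB i j : ℂ) * (F (hA.eigenvalues i) - F (hB.eigenvalues j)) := by
    simp only [mul_sub, Finset.sum_sub_distrib]
    rw [hA.eigSum_eq, hB.eigSum_eq]
    congr 1
    · refine Finset.sum_congr rfl fun i _ => ?_
      rw [← Finset.sum_mul, ← Complex.ofReal_sum, hrow, Complex.ofReal_one, one_mul]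
    · rw [Finset.sum_comm]
      refine Finset.sum_congr rfl fun i _ => ?_
      rw [← Finset.sum_mul, ← Complex.ofReal_sum, hcol, Complex.ofReal_one, one_mul]
  rw [h1, ← sum_overlap_mul_norm_sub_sq hA hB w]
  calc _ ≤ ∑ i, ∑ j, ‖(hA.overlap hB i j : ℂ) * (F (hA.eigenvalues i) - F (hB.eigenvalues j))‖ :=
        (norm_sum_le _ _).trans (Finset.sum_le_sum fun i _ => norm_sum_le _ _)
    _ ≤ ∑ i, ∑ j, (ε * hA.overlap hB i j + C * (hA.overlap hB i j *
          ‖w (hA.eigenvalues i) - w (hB.eigenvalues j)‖ ^ 2)) := by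
        refine Finset.sum_le_sum fun i _ => Finset.sum_le_sum fun j _ => ?_
        have h0 : 0 ≤ hA.overlap hB i j := sq_nonneg _
        rw [norm_mul, Complex.norm_real, Real.norm_of_nonneg h0]
        nlinarith [mul_le_mul_of_nonneg_left (hF (hA.eigenvalues i) (hB.eigenvalues j)) h0]
    _ = _ := by
        simp only [Finset.sum_add_distrib, ← Finset.mul_sum, hrow]
        simp

theorem norm_eigSum_sub_le_frobSq (hA : A.IsHermitian) (hB : B.IsHermitian) (F : ℂ → ℂ)
    {ε C : ℝ} (hF : ∀ x y : ℝ, ‖F x - F y‖ ≤ ε + C * |x - y| ^ 2) :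
    ‖eigSum F A - eigSum F B‖ ≤ ε * Fintype.card N + C * (A - B).frobSq := by
  have h := norm_eigSum_sub_le hA hB (fun x => (x : ℂ)) F (ε := ε) (C := C) (fun x y => by
    rw [← Complex.ofReal_sub, Complex.norm_real, Real.norm_eq_abs]; exact hF x y)
  rwa [applyFun_ofReal, applyFun_ofReal] at h

/-- The resolvent at `-i` as a function of the spectral parameter. -/
noncomputable def _root_.resolventFun (x : ℝ) : ℂ := ((x : ℂ) + Complex.I)⁻¹

theorem _root_.ofReal_add_I_ne_zero (x : ℝ) : (x : ℂ) + Complex.I ≠ 0 := by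
  intro h
  simpa using congrArg Complex.im h

theorem _root_.norm_resolventFun (x : ℝ) : ‖resolventFun x‖ = (√(x ^ 2 + 1))⁻¹ := by
  rw [resolventFun, norm_inv]
  congr 1
  have := Complex.norm_add_mul_I x 1
  simpa using this

theorem _root_.norm_resolventFun_le_one (x : ℝ) : ‖resolventFun x‖ ≤ 1 := by
  rw [norm_resolventFun]
  refine inv_le_one_of_one_le₀ (Real.one_le_sqrt.2 ?_)
  nlinarith [sq_nonneg x]

/-- The second resolvent identity. The product form on the right transfers a rank bound from `B - A`
to the difference of resolvents. -/
theorem resolvent_sub_resolvent (hA : A.IsHermitian) (hB : B.IsHermitian) :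
    hA.applyFun resolventFun - hB.applyFun resolventFun =
      hA.applyFun resolventFun * (B - A) * hB.applyFun resolventFun := by
  have e1 : hA.applyFun resolventFun * (A + hA.applyFun (fun _ => Complex.I)) = 1 := by
    nth_rewrite 2 [← hA.applyFun_ofReal]
    rw [applyFun_add, applyFun_mul, ← hA.applyFun_one]
    congr 1
    funext x
    exact inv_mul_cancel₀ (ofReal_add_I_ne_zero x)
  have e2 : (B + hB.applyFun (fun _ => Complex.I)) * hB.applyFun resolventFun = 1 := by
    nth_rewrite 1 [← hB.applyFun_ofReal]
    rw [applyFun_add, applyFun_mul, ← hB.applyFun_one]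
    congr 1
    funext x
    exact mul_inv_cancel₀ (ofReal_add_I_ne_zero x)
  have e3 : ∀ {A : Matrix N N ℂ} (hA : A.IsHermitian),
      hA.applyFun (fun _ => Complex.I) = Complex.I • 1 := by
    intro A hA
    rw [← hA.applyFun_one, applyFun, applyFun, ← Matrix.smul_mul, ← Matrix.mul_smul,
      ← diagonal_smul]
    simp [Pi.smul_def]
  rw [e3] at e1 e2
  have : B - A = (B + Complex.I • 1) - (A + Complex.I • 1) := by abel
  rw [this, Matrix.mul_sub, Matrix.sub_mul, e1, Matrix.mul_assoc, e2, Matrix.mul_one, Matrix.one_mul]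

section L2
open scoped Matrix.Norms.L2Operator ComplexOrder

theorem norm_applyFun_le (hA : A.IsHermitian) {w : ℝ → ℂ} (hw : ∀ x, ‖w x‖ ≤ 1) :
    ‖hA.applyFun w‖ ≤ 1 := by
  have h1 : ‖diagonal (fun i => w (hA.eigenvalues i))‖ ≤ 1 := by
    rw [l2_opNorm_diagonal]
    exact (pi_norm_le_iff_of_nonneg zero_le_one).2 fun i => hw _
  rw [applyFun, mul_assoc]
  erw [CStarRing.norm_coe_unitary_mul, ← Unitary.coe_star, CStarRing.norm_mul_coe_unitary]
  exact h1

/-- The squared Frobenius norm is the sum of the eigenvalues of `Xᴴ * X`; only `rank X` of them are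
nonzero, and each is at most `‖X‖ ^ 2`. -/
theorem _root_.Matrix.frobSq_le_rank {X : Matrix N N ℂ} {c : ℝ} (hX : ‖X‖ ≤ c) :
    X.frobSq ≤ c ^ 2 * X.rank := by
  have hH : (Xᴴ * X).IsHermitian := isHermitian_conjTranspose_mul_self X
  have h1 : X.frobSq = ∑ i, hH.eigenvalues i := by
    have := trace_conjTranspose_mul_self X
    rw [hH.trace_eq_sum_eigenvalues] at this
    refine Complex.ofReal_injective (this.symm.trans ?_)
    push_cast
    rfl
  have hc : 0 ≤ c := (norm_nonneg _).trans hX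
  have h2 : ∀ i, hH.eigenvalues i ≤ c ^ 2 := by
    intro i
    have h3 : ((hH.eigenvalues i : ℝ) : ℂ) ∈ spectrum ℂ (Xᴴ * X) := by
      rw [hH.spectrum_eq_image_range]
      exact ⟨_, ⟨i, rfl⟩, rfl⟩
    have h4 := spectrum.norm_le_norm_mul_of_mem h3
    have h6 : Nonempty N := ⟨i⟩
    have : Nontrivial (Matrix N N ℂ) := inferInstance
    rw [CStarRing.norm_one, mul_one, Complex.norm_real] at h4
    have h5 : ‖Xᴴ * X‖ ≤ c ^ 2 := by
      rw [l2_opNorm_conjTranspose_mul_self, sq]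
      exact mul_le_mul hX hX (norm_nonneg _) hc
    exact (Real.le_norm_self _).trans (h4.trans h5)
  rw [h1, ← rank_conjTranspose_mul_self, hH.rank_eq_card_non_zero_eigs, Fintype.card_subtype,
    ← Finset.sum_filter_ne_zero, mul_comm, ← nsmul_eq_mul]
  exact Finset.sum_le_card_nsmul _ _ _ fun i _ => h2 i

/-- The factor is `2 ^ 2`, as each resolvent has norm at most 1. The norm of `B - A` does not enter.
-/
theorem frobSq_resolvent_sub_le (hA : A.IsHermitian) (hB : B.IsHermitian) :
    (hA.applyFun resolventFun - hB.applyFun resolventFun).frobSq ≤ 4 * (B - A).rank := by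
  have h1 : ‖hA.applyFun resolventFun - hB.applyFun resolventFun‖ ≤ 2 := by
    refine (norm_sub_le _ _).trans ?_
    have := norm_applyFun_le hA norm_resolventFun_le_one
    have := norm_applyFun_le hB norm_resolventFun_le_one
    linarith
  refine (frobSq_le_rank h1).trans ?_
  have h2 : (hA.applyFun resolventFun - hB.applyFun resolventFun).rank ≤ (B - A).rank := by
    rw [resolvent_sub_resolvent]
    exact (rank_mul_le_left _ _).trans (rank_mul_le_right _ _)
  have : ((hA.applyFun resolventFun - hB.applyFun resolventFun).rank : ℝ) ≤ (B - A).rank := by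
    exact_mod_cast h2
  linarith

end L2

theorem norm_eigSum_sub_le_rank (hA : A.IsHermitian) (hB : B.IsHermitian) (F : ℂ → ℂ)
    {ε C : ℝ} (hC : 0 ≤ C)
    (hF : ∀ x y : ℝ, ‖F x - F y‖ ≤ ε + C * ‖resolventFun x - resolventFun y‖ ^ 2) :
    ‖eigSum F A - eigSum F B‖ ≤ ε * Fintype.card N + C * (4 * (B - A).rank) := by
  refine (norm_eigSum_sub_le hA hB _ F hF).trans ?_
  gcongr
  exact frobSq_resolvent_sub_le hA hB

end IsHermitian

end Matrix

/-! ### Moduli of continuity of test functions -/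

/-- The distance of resolvents controls a compactly supported function. -/
theorem exists_norm_sub_le_resolventFun {F : ℂ → ℂ} (hF : Continuous F) (hc : HasCompactSupport F)
    {ε : ℝ} (hε : 0 < ε) : ∃ C : ℝ, 0 ≤ C ∧
      ∀ x y : ℝ, ‖F x - F y‖ ≤ ε + C * ‖resolventFun x - resolventFun y‖ ^ 2 := by
  obtain ⟨K, hK⟩ := hc.exists_bound_of_continuous hF
  obtain ⟨M, hM0, hM⟩ : ∃ M : ℝ, 0 < M ∧ ∀ x : ℝ, M < |x| → F x = 0 := by
    obtain ⟨M, hM⟩ := hc.isCompact.isBounded.subset_closedBall 0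
    refine ⟨max M 1, by positivity, fun x hx => ?_⟩
    by_contra h
    have := hM (subset_tsupport F h)
    rw [mem_closedBall_zero_iff, Complex.norm_real, Real.norm_eq_abs] at this
    exact absurd (lt_of_le_of_lt (le_max_left _ _) hx) (not_lt.2 this)
  have hK0 : 0 ≤ K := (norm_nonneg _).trans (hK 0)
  obtain ⟨δ, hδ, hFδ⟩ := Metric.uniformContinuous_iff.1
    (hc.uniformContinuous_of_continuous hF) ε hε
  -- For `|x| ≤ M` and `|x - y| = t`, the resolvents differ by at least `t / ((1 + M) (1 + M + t))`,
  -- which increases with `t`; `D` is its value at `t = δ`.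
  set D : ℝ := δ / ((1 + M) * (1 + M + δ)) with hD
  have hD0 : 0 < D := by positivity
  have hsq : ∀ x : ℝ, √(x ^ 2 + 1) ≤ 1 + |x| := by
    intro x
    rw [Real.sqrt_le_left (by positivity)]
    nlinarith [abs_nonneg x, sq_abs x]
  have key : ∀ x y : ℝ, |x| ≤ M → δ ≤ |x - y| → D ≤ ‖resolventFun x - resolventFun y‖ := by
    intro x y hx hxy
    have h1 : resolventFun x - resolventFun y = ((y - x : ℝ) : ℂ) * (resolventFun x * resolventFun y) := by
      have := ofReal_add_I_ne_zero x
      have := ofReal_add_I_ne_zero y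
      simp only [resolventFun]
      push_cast
      field_simp
      ring
    rw [h1, norm_mul, norm_mul, norm_resolventFun, norm_resolventFun, Complex.norm_real,
      Real.norm_eq_abs, abs_sub_comm, hD, ← mul_inv, ← div_eq_mul_inv]
    have hy : |y| ≤ M + |x - y| := by
      have := abs_sub_abs_le_abs_sub y x
      rw [abs_sub_comm] at this
      linarith
    have h2 : √(x ^ 2 + 1) * √(y ^ 2 + 1) ≤ (1 + M) * (1 + M + |x - y|) := by
      have h3 := hsq x
      have h4 := hsq y
      exact mul_le_mul (by linarith) (by linarith) (by positivity) (by linarith)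
    refine le_trans ?_ (div_le_div_of_nonneg_left (abs_nonneg _) (by positivity) h2)
    rw [div_le_div_iff₀ (by positivity) (by positivity)]
    nlinarith [mul_le_mul_of_nonneg_left hxy (by positivity : 0 ≤ (1 + M) * (1 + M))]
  -- For `|x - y| < δ` the term `ε` suffices. Otherwise either both values of `F` vanish or the
  -- resolvents are at least `D` apart, and the constant turns `D ^ 2` into the trivial bound `2 *
  -- K`.
  refine ⟨2 * K / D ^ 2, by positivity, fun x y => ?_⟩
  by_cases hxy : |x - y| < δ
  · have h1 : dist (F x) (F y) < ε := hFδ (by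
      rw [Complex.dist_eq, ← Complex.ofReal_sub, Complex.norm_real]; exact hxy)
    rw [dist_eq_norm] at h1
    have : 0 ≤ 2 * K / D ^ 2 * ‖resolventFun x - resolventFun y‖ ^ 2 := by positivity
    linarith
  · push Not at hxy
    by_cases h0 : M < |x| ∧ M < |y|
    · rw [hM x h0.1, hM y h0.2, sub_self, norm_zero]
      positivity
    · have h1 : D ≤ ‖resolventFun x - resolventFun y‖ := by
        rcases not_and_or.1 h0 with h | h
        · exact key x y (not_lt.1 h) hxy
        · rw [norm_sub_rev]
          exact key y x (not_lt.1 h) (by rwa [abs_sub_comm])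
      have h2 : ‖F x - F y‖ ≤ 2 * K := (norm_sub_le _ _).trans (by linarith [hK x, hK y])
      have h3 : 2 * K ≤ 2 * K / D ^ 2 * ‖resolventFun x - resolventFun y‖ ^ 2 := by
        rw [div_mul_eq_mul_div, le_div_iff₀ (by positivity)]
        gcongr
      linarith

/-- The distance of arguments controls a compactly supported function. -/
theorem exists_norm_sub_le_abs {F : ℂ → ℂ} (hF : Continuous F) (hc : HasCompactSupport F)
    {ε : ℝ} (hε : 0 < ε) : ∃ C : ℝ, 0 ≤ C ∧
      ∀ x y : ℝ, ‖F x - F y‖ ≤ ε + C * |x - y| ^ 2 := by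
  obtain ⟨C, hC, h⟩ := exists_norm_sub_le_resolventFun hF hc hε
  refine ⟨C, hC, fun x y => (h x y).trans ?_⟩
  have h1 : resolventFun x - resolventFun y = ((y - x : ℝ) : ℂ) * (resolventFun x * resolventFun y) := by
    have := ofReal_add_I_ne_zero x
    have := ofReal_add_I_ne_zero y
    simp only [resolventFun]
    push_cast
    field_simp
    ring
  -- The resolvent function is 1-Lipschitz, so the same constant serves.
  have h2 : ‖resolventFun x - resolventFun y‖ ≤ |x - y| := by
    rw [h1, norm_mul, norm_mul, Complex.norm_real, Real.norm_eq_abs, abs_sub_comm]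
    refine mul_le_of_le_one_right (abs_nonneg _) ?_
    exact mul_le_one₀ (norm_resolventFun_le_one _) (norm_nonneg _) (norm_resolventFun_le_one _)
  gcongr

/-! ### Riemann sums over the immersed nodes -/

section RiemannSums

variable {d ν : ℕ}

theorem tendsto_eval_pi_atTop (q : Fin d) : Tendsto (fun n : Fin d → ℕ => n q) atTop atTop :=
  tendsto_atTop.2 fun b => (eventually_ge_atTop fun _ => b).mono fun _ h => h q

theorem eventually_forall_lt_atTop (b : ℝ) :
    ∀ᶠ n : Fin d → ℕ in atTop, ∀ q, b < (n q : ℝ) :=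
  eventually_all.2 fun q =>
    (tendsto_natCast_atTop_atTop.comp (tendsto_eval_pi_atTop q)).eventually_gt_atTop b

/-- The half-open cell of the index `i` in the uniform subdivision of the cube. -/
def gridCell (n : Fin d → ℕ) (i : ∀ q, Fin (n q)) : Set (Fin d → ℝ) :=
  Set.univ.pi fun q => Set.Ico ((i q : ℕ) / (n q : ℝ)) (((i q : ℕ) + 1) / (n q : ℝ))

theorem measurableSet_gridCell (n : Fin d → ℕ) (i : ∀ q, Fin (n q)) :
    MeasurableSet (gridCell n i) :=
  MeasurableSet.univ_pi fun _ => measurableSet_Ico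

theorem volume_gridCell (n : Fin d → ℕ) (i : ∀ q, Fin (n q)) :
    volume.real (gridCell n i) = (∏ q, (n q : ℝ))⁻¹ := by
  rw [measureReal_def, gridCell, Real.volume_pi_Ico_toReal, ← Finset.prod_inv_distrib]
  · refine Finset.prod_congr rfl fun q _ => ?_
    rw [← sub_div, add_sub_cancel_left, one_div]
  · intro q
    dsimp only
    gcongr
    linarith

theorem eq_floor_of_mem_gridCell {n : Fin d → ℕ} {i : ∀ q, Fin (n q)} {x : Fin d → ℝ}
    (h : x ∈ gridCell n i) (q : Fin d) : (i q : ℕ) = ⌊x q * n q⌋₊ := by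
  have hn : 0 < (n q : ℝ) := by exact_mod_cast (i q).pos
  obtain ⟨h1, h2⟩ := h q trivial
  rw [div_le_iff₀ hn] at h1
  rw [lt_div_iff₀ hn] at h2
  exact ((Nat.floor_eq_iff (le_trans (Nat.cast_nonneg _) h1)).2 ⟨h1, h2⟩).symm

theorem exists_mem_gridCell {n : Fin d → ℕ} (hn : ∀ q, 0 < n q) {x : Fin d → ℝ}
    (hx : x ∈ Set.univ.pi fun _ : Fin d => Set.Ico (0 : ℝ) 1) : ∃ i, x ∈ gridCell n i := by
  have hn' : ∀ q, 0 < (n q : ℝ) := fun q => by exact_mod_cast hn q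
  have h0 : ∀ q, 0 ≤ x q * n q := fun q => mul_nonneg (hx q trivial).1 (hn' q).le
  refine ⟨fun q => ⟨⌊x q * n q⌋₊, ?_⟩, fun q _ => ⟨?_, ?_⟩⟩
  · rw [Nat.floor_lt (h0 q)]
    nlinarith [(hx q trivial).2, hn' q]
  · rw [div_le_iff₀ (hn' q)]
    exact Nat.floor_le (h0 q)
  · rw [lt_div_iff₀ (hn' q)]
    exact Nat.lt_floor_add_one _

theorem gridCell_subset {n : Fin d → ℕ} (i : ∀ q, Fin (n q)) :
    gridCell n i ⊆ Set.univ.pi fun _ : Fin d => Set.Ico (0 : ℝ) 1 := by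
  intro x hx q _
  have hn : 0 < (n q : ℝ) := by exact_mod_cast (i q).pos
  obtain ⟨h1, h2⟩ := hx q trivial
  refine ⟨le_trans (by positivity) h1, h2.trans_le ?_⟩
  rw [div_le_one hn]
  exact_mod_cast (i q).2

variable [NeZero d]

/-- Every node lies in the closure of its cell. -/
theorem immersion_mem_Icc (n : Fin d → ℕ) (v : DiamondNode n ν) (q : Fin d) :
    immersion n v q ∈ Set.Icc (((v.1 q : ℕ) : ℝ) / (n q : ℝ)) ((((v.1 q : ℕ) : ℝ) + 1) / (n q : ℝ)) := by
  have hn : 0 < (n q : ℝ) := by exact_mod_cast (v.1 q).pos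
  have hi : ((v.1 q : ℕ) : ℝ) + 1 ≤ n q := by exact_mod_cast (v.1 q).2
  have hi0 : (0 : ℝ) ≤ ((v.1 q : ℕ) : ℝ) := Nat.cast_nonneg _
  have hr : ((v.2 : ℕ) : ℝ) + 1 ≤ ν := by exact_mod_cast v.2.2
  have hr0 : (0 : ℝ) ≤ ((v.2 : ℕ) : ℝ) := Nat.cast_nonneg _
  have hν : (0 : ℝ) ≤ ν := Nat.cast_nonneg _
  unfold immersion
  split_ifs
  · constructor
    · rw [div_le_div_iff₀ hn (by positivity)]
      nlinarith [mul_nonneg hr0 hn.le]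
    · rw [div_le_div_iff₀ (by positivity) hn]
      nlinarith [mul_le_mul_of_nonneg_right hr hn.le]
  · constructor
    · rw [div_le_div_iff₀ hn (by positivity)]
      nlinarith
    · rw [div_le_div_iff₀ (by positivity) hn]
      nlinarith

/-- The sums over the nodes with a given index inside the diamonds are Riemann sums. -/
theorem tendsto_riemannSum (r : Fin ν) {ψ : (Fin d → ℝ) → ℝ} {K : ℝ} (hK : ∀ x, |ψ x| ≤ K)
    (hψ : ∀ᵐ x : Fin d → ℝ, x ∈ Set.Icc (0 : Fin d → ℝ) 1 → ContinuousAt ψ x) :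
    Tendsto (fun n : Fin d → ℕ => (∏ q, (n q : ℝ))⁻¹ * ∑ i, ψ (immersion n (i, r))) atTop
      (𝓝 (∫ x in Set.Icc (0 : Fin d → ℝ) 1, ψ x)) := by
  set Q : Set (Fin d → ℝ) := Set.univ.pi fun _ : Fin d => Set.Ico (0 : ℝ) 1 with hQ
  have hQm : MeasurableSet Q := MeasurableSet.univ_pi fun _ => measurableSet_Ico
  have hQI : Q =ᵐ[volume] Set.Icc (0 : Fin d → ℝ) 1 :=
    Measure.univ_pi_Ico_ae_eq_Icc (f := (0 : Fin d → ℝ)) (g := 1)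
  have hQs : Q ⊆ Set.Icc (0 : Fin d → ℝ) 1 := fun x hx =>
    ⟨fun q => (hx q trivial).1, fun q => (hx q trivial).2.le⟩
  -- Step functions whose integrals are exactly the Riemann sums, since all cells have volume `1 / ∏
  -- n_q`. The cells are half-open, hence disjoint, and dominated convergence applies.
  set s : (Fin d → ℕ) → (Fin d → ℝ) → ℝ := fun n x =>
    ∑ i, (gridCell n i).indicator (fun _ => ψ (immersion n (i, r))) x with hs
  have hint : ∀ n, ∫ x, s n x = (∏ q, (n q : ℝ))⁻¹ * ∑ i, ψ (immersion n (i, r)) := by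
    intro n
    have hfin : ∀ i, volume (gridCell n i) ≠ ⊤ := fun i =>
      ne_top_of_le_ne_top (measure_Icc_lt_top (a := (0 : Fin d → ℝ)) (b := 1)).ne
        (measure_mono ((gridCell_subset i).trans hQs))
    rw [integral_finsetSum _ fun i _ => (integrable_indicator_iff (measurableSet_gridCell n i)).2
      (integrableOn_const (hfin i)), Finset.mul_sum]
    refine Finset.sum_congr rfl fun i _ => ?_
    rw [integral_indicator_const _ (measurableSet_gridCell n i), volume_gridCell, smul_eq_mul]
  have hval : ∀ n i x, x ∈ gridCell n i → s n x = ψ (immersion n (i, r)) := by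
    intro n i x hx
    rw [hs]
    dsimp only
    rw [Finset.sum_eq_single i, Set.indicator_of_mem hx]
    · intro j _ hj
      refine Set.indicator_of_notMem (fun hxj => hj ?_) _
      funext q
      exact Fin.ext ((eq_floor_of_mem_gridCell hxj q).trans (eq_floor_of_mem_gridCell hx q).symm)
    · simp
  have hout : ∀ n x, x ∉ Q → s n x = 0 := fun n x hx =>
    Finset.sum_eq_zero fun i _ => Set.indicator_of_notMem (fun h => hx (gridCell_subset i h)) _
  have hK0 : 0 ≤ K := (abs_nonneg _).trans (hK 0)
  have hbound : ∀ n x, ‖s n x‖ ≤ Q.indicator (fun _ => K) x := by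
    intro n x
    by_cases hx : x ∈ Q
    · rw [Set.indicator_of_mem hx]
      by_cases h : ∃ i, x ∈ gridCell n i
      · obtain ⟨i, hi⟩ := h
        rw [hval n i x hi]
        exact hK _
      · have : s n x = 0 := Finset.sum_eq_zero fun i _ =>
          Set.indicator_of_notMem (fun h' => h ⟨i, h'⟩) _
        rw [this, norm_zero]
        exact hK0
    · rw [hout n x hx, Set.indicator_of_notMem hx, norm_zero]
  have hlim : Tendsto (fun n => ∫ x, s n x) atTop (𝓝 (∫ x, Q.indicator ψ x)) := by
    refine tendsto_integral_filter_of_dominated_convergence (Q.indicator fun _ => K)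
      (Eventually.of_forall fun n => ?_) (Eventually.of_forall fun n =>
        Eventually.of_forall (hbound n)) ?_ ?_
    · refine Measurable.aestronglyMeasurable ?_
      exact Finset.measurable_fun_sum _ fun i _ =>
        measurable_const.indicator (measurableSet_gridCell n i)
    · rw [integrable_indicator_iff hQm]
      exact integrableOn_const (ne_top_of_le_ne_top
        (measure_Icc_lt_top (a := (0 : Fin d → ℝ)) (b := 1)).ne (measure_mono hQs))
    · filter_upwards [hψ] with x hx
      by_cases hxQ : x ∈ Q
      · rw [Set.indicator_of_mem hxQ, Metric.tendsto_nhds]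
        intro ε hε
        -- The node and `x` lie in the closure of one cell, so in direction `q` they differ by at
        -- most `1 / n_q`.
        obtain ⟨δ, hδ, hδε⟩ := Metric.continuousAt_iff.1 (hx (hQs hxQ)) ε hε
        filter_upwards [eventually_forall_lt_atTop (d := d) (δ⁻¹), eventually_forall_lt_atTop (d := d) 0]
          with n hn hn0
        obtain ⟨i, hi⟩ := exists_mem_gridCell (n := n) (fun q => by exact_mod_cast hn0 q) hxQ
        rw [hval n i x hi]
        refine hδε ((dist_pi_lt_iff hδ).2 fun q => ?_)
        have h1 := immersion_mem_Icc n (i, r) q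
        have h2 : x q ∈ Set.Ico (((i q : ℕ) : ℝ) / (n q : ℝ)) ((((i q : ℕ) : ℝ) + 1) / (n q : ℝ)) :=
          hi q trivial
        have h3 : (n q : ℝ)⁻¹ < δ := inv_lt_of_inv_lt₀ hδ (hn q)
        have h4 : (((i q : ℕ) : ℝ) + 1) / (n q : ℝ) = ((i q : ℕ) : ℝ) / (n q : ℝ) + (n q : ℝ)⁻¹ := by
          rw [add_div, one_div]
        rw [h4] at h1 h2
        rw [Real.dist_eq, abs_lt]
        constructor <;> linarith [h1.1, h1.2, h2.1, h2.2]
      · rw [Set.indicator_of_notMem hxQ]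
        exact tendsto_const_nhds.congr fun n => (hout n x hxQ).symm
  simp only [hint] at hlim
  rwa [integral_indicator hQm, Measure.restrict_congr_set hQI] at hlim

end RiemannSums

/-! ### Trigonometric polynomials and the symbol -/

section Symbols

variable {d m ν : ℕ}

/-- Trigonometric polynomials in `d` variables with matrix coefficients. -/
abbrev TrigPoly (d ν : ℕ) : Type := AddMonoidAlgebra (Matrix (Fin ν) (Fin ν) ℂ) (Fin d → ℤ)

/-- The character `θ ↦ exp (i δ · θ)`. -/
noncomputable def expChar (θ : Fin d → ℝ) (δ : Fin d → ℤ) : ℂ :=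
  Complex.exp (((∑ q, (δ q : ℝ) * θ q : ℝ) : ℂ) * Complex.I)

theorem expChar_zero (θ : Fin d → ℝ) : expChar θ 0 = 1 := by simp [expChar]

theorem expChar_add (θ : Fin d → ℝ) (δ η : Fin d → ℤ) :
    expChar θ (δ + η) = expChar θ δ * expChar θ η := by
  rw [expChar, expChar, expChar, ← Complex.exp_add, ← add_mul, ← Complex.ofReal_add,
    ← Finset.sum_add_distrib]
  simp [add_mul]

theorem continuous_expChar (δ : Fin d → ℤ) : Continuous fun θ : Fin d → ℝ => expChar θ δ := by
  unfold expChar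
  fun_prop

/-- The evaluation of trigonometric polynomials at `θ`. -/
noncomputable def evalTrig (θ : Fin d → ℝ) : TrigPoly d ν →+* Matrix (Fin ν) (Fin ν) ℂ :=
  AddMonoidAlgebra.liftNCRingHom (RingHom.id _)
    { toFun := fun δ => expChar θ δ.toAdd • (1 : Matrix (Fin ν) (Fin ν) ℂ)
      map_one' := by rw [toAdd_one, expChar_zero, one_smul]
      map_mul' := fun δ η => by
        rw [toAdd_mul, expChar_add, smul_mul_smul_comm, mul_one] }
    -- The characters act through scalar matrices, which commute with the coefficients; evaluation
    -- is therefore multiplicative.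
    fun x y => by
      change x * (expChar θ y.toAdd • (1 : Matrix (Fin ν) (Fin ν) ℂ)) =
        (expChar θ y.toAdd • (1 : Matrix (Fin ν) (Fin ν) ℂ)) * x
      rw [mul_smul_comm, smul_mul_assoc, mul_one, one_mul]

theorem evalTrig_single (θ : Fin d → ℝ) (δ : Fin d → ℤ) (B : Matrix (Fin ν) (Fin ν) ℂ) :
    evalTrig θ (AddMonoidAlgebra.single δ B) = expChar θ δ • B := by
  rw [evalTrig, AddMonoidAlgebra.liftNCRingHom_single]
  change B * (expChar θ δ • (1 : Matrix (Fin ν) (Fin ν) ℂ)) = _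
  rw [mul_smul_comm, mul_one]

theorem evalTrig_eq_sum (θ : Fin d → ℝ) (b : TrigPoly d ν) :
    evalTrig θ b = ∑ δ ∈ b.coeff.support, expChar θ δ • b.coeff δ := by
  conv_lhs => rw [← AddMonoidAlgebra.sum_coeff_single b]
  rw [Finsupp.sum, map_sum]
  simp only [evalTrig_single]

theorem continuous_evalTrig (b : TrigPoly d ν) : Continuous fun θ : Fin d → ℝ => evalTrig θ b := by
  simp only [evalTrig_eq_sum]
  exact continuous_finsetSum _ fun δ _ => (continuous_expChar δ).smul continuous_const

/-- The character is a product over the coordinates, so the integral factors, and a factor with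
nonzero frequency integrates to zero over a full period. -/
theorem integral_expChar (δ : Fin d → ℤ) :
    ∫ θ in Set.Icc (fun _ : Fin d => -Real.pi) (fun _ => Real.pi), expChar θ δ =
      if δ = 0 then ((2 * Real.pi) ^ d : ℂ) else 0 := by
  have h1 : ∀ k : ℤ, ∫ t in Set.Icc (-Real.pi) Real.pi, Complex.exp (((k : ℂ) * Complex.I) * (t : ℂ)) =
      if k = 0 then (2 * Real.pi : ℂ) else 0 := by
    intro k
    rw [integral_Icc_eq_integral_Ioc,
      ← intervalIntegral.integral_of_le (by linarith [Real.pi_pos])]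
    split_ifs with hk
    · subst hk
      simp
      ring
    · have hk' : (k : ℂ) * Complex.I ≠ 0 := mul_ne_zero (by exact_mod_cast hk) Complex.I_ne_zero
      rw [integral_exp_mul_complex hk', div_eq_zero_iff]
      left
      rw [sub_eq_zero, Complex.exp_eq_exp_iff_exists_int]
      refine ⟨k, ?_⟩
      push_cast
      ring
  rw [← Set.pi_univ_Icc, volume_pi, Measure.restrict_pi_pi]
  have h2 : ∀ θ : Fin d → ℝ, expChar θ δ = ∏ q, Complex.exp (((δ q : ℂ) * Complex.I) * (θ q : ℂ)) := by
    intro θ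
    rw [expChar, ← Complex.exp_sum, Complex.ofReal_sum, Finset.sum_mul]
    congr 1
    refine Finset.sum_congr rfl fun q _ => ?_
    push_cast
    ring
  simp only [h2]
  rw [integral_fintype_prod_eq_prod (fun q (t : ℝ) => Complex.exp (((δ q : ℂ) * Complex.I) * (t : ℂ)))]
  simp only [h1]
  split_ifs with h
  · subst h
    simp
  · obtain ⟨q, hq⟩ := Function.ne_iff.1 h
    exact Finset.prod_eq_zero (Finset.mem_univ q) (if_neg hq)

/-- The mean of the trace of a trigonometric polynomial is the trace of the constant term. -/
theorem integral_trace_evalTrig (b : TrigPoly d ν) :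
    ∫ θ in Set.Icc (fun _ : Fin d => -Real.pi) (fun _ => Real.pi), (evalTrig θ b).trace =
      (2 * Real.pi) ^ d * (b.coeff 0).trace := by
  simp only [evalTrig_eq_sum, Matrix.trace_sum, Matrix.trace_smul]
  rw [integral_finsetSum]
  · simp only [smul_eq_mul, integral_mul_const, integral_expChar]
    rw [Finset.sum_eq_single 0]
    · simp
    · intro δ _ h
      rw [if_neg h, zero_mul]
    · intro h
      rw [Finsupp.notMem_support_iff.1 h]
      simp
  · intro δ _
    exact (((continuous_expChar δ).smul continuous_const).continuousOn).integrableOn_compact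
      isCompact_Icc

namespace DiamondData

/-- The trigonometric polynomial `c - f`, `f` the symbol of the diamond Toeplitz graphs. -/
noncomputable def shiftedPoly (T : DiamondData d m ν) (c : ℝ) : TrigPoly d ν :=
  AddMonoidAlgebra.single 0 ((c : ℂ) • 1 - T.mold.adjMatrix.map Complex.ofReal) -
    ∑ k, ∑ α : directions (T.t k),
      (AddMonoidAlgebra.single α.1 ((T.L k α).map Complex.ofReal) +
        AddMonoidAlgebra.single (-α.1) ((T.L k α).transpose.map Complex.ofReal))

/-- Ties the polynomial to the graph: off the constant term, its coefficients are the negated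
linking blocks. -/
theorem coeff_shiftedPoly (T : DiamondData d m ν) (c : ℝ) (δ : Fin d → ℤ) :
    (T.shiftedPoly c).coeff δ =
      (if δ = 0 then (c : ℂ) • 1 else 0) - (T.block δ).map Complex.ofReal := by
  rw [shiftedPoly, AddMonoidAlgebra.coeff_sub, AddMonoidAlgebra.coeff_sum, Finsupp.sub_apply,
    Finsupp.finsetSum_apply]
  simp only [AddMonoidAlgebra.coeff_sum, AddMonoidAlgebra.coeff_add, AddMonoidAlgebra.coeff_single,
    Finsupp.finsetSum_apply, Finsupp.add_apply, Finsupp.single_apply]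
  unfold block
  by_cases h : δ = 0
  · subst h
    rw [if_pos rfl, if_pos rfl, if_pos rfl, Finset.sum_eq_zero, sub_zero]
    intro k _
    refine Finset.sum_eq_zero fun α _ => ?_
    have := ne_zero_of_mem_directions α.2
    rw [if_neg this, if_neg (by simpa using this), add_zero]
  · rw [if_neg (Ne.symm h), if_neg h, if_neg h]
    congr 1
    ext r s
    simp only [Matrix.map_apply, Matrix.sum_apply, Matrix.add_apply, Complex.ofReal_sum]
    refine Finset.sum_congr rfl fun k _ => Finset.sum_congr rfl fun α _ => ?_
    rw [Complex.ofReal_add]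
    congr 1
    · by_cases h1 : δ = α.1
      · rw [if_pos h1.symm, if_pos h1]
        rfl
      · rw [if_neg (Ne.symm h1), if_neg h1]
        simp
    · by_cases h1 : δ = -α.1
      · rw [if_pos h1.symm, if_pos h1]
        rfl
      · rw [if_neg (Ne.symm h1), if_neg h1]
        simp

/-- By Euler's formula, `L exp(iα·θ) + Lᵀ exp(-iα·θ)` is the cosine and sine form used in the
symbol. -/
theorem evalTrig_shiftedPoly (T : DiamondData d m ν) (c : ℝ) (θ : Fin d → ℝ) :
    evalTrig θ (T.shiftedPoly c) = (c : ℂ) • 1 - T.symbol θ := by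
  rw [shiftedPoly, symbol, map_sub, map_sum, evalTrig_single, expChar_zero, one_smul, sub_sub]
  congr 2
  refine Finset.sum_congr rfl fun k _ => ?_
  rw [map_sum]
  refine Finset.sum_congr rfl fun α _ => ?_
  rw [map_add, evalTrig_single, evalTrig_single]
  have h1 : expChar θ (-α.1) = Complex.cos ((∑ r, (α.1 r : ℝ) * θ r : ℝ) : ℂ) -
      Complex.sin ((∑ r, (α.1 r : ℝ) * θ r : ℝ) : ℂ) * Complex.I := by
    rw [← Complex.cos_neg, sub_eq_add_neg, ← neg_mul, ← Complex.sin_neg, ← Complex.exp_mul_I, expChar]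
    congr 2
    rw [← Complex.ofReal_neg, ← Finset.sum_neg_distrib]
    simp
  have h2 : expChar θ α.1 = Complex.cos ((∑ r, (α.1 r : ℝ) * θ r : ℝ) : ℂ) +
      Complex.sin ((∑ r, (α.1 r : ℝ) * θ r : ℝ) : ℂ) * Complex.I := Complex.exp_mul_I _
  rw [h1, h2]
  ext r s
  simp only [Matrix.add_apply, Matrix.smul_apply, Matrix.map_apply, Matrix.transpose_apply,
    Matrix.sub_apply, smul_eq_mul, Complex.ofReal_cos, Complex.ofReal_sin, Complex.ofReal_add,
    Complex.ofReal_sub]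
  ring

theorem isHermitian_shifted_symbol (T : DiamondData d m ν) (c : ℝ) (θ : Fin d → ℝ) :
    ((c : ℂ) • 1 - T.symbol θ).IsHermitian := by
  ext r s
  have hW := T.mold.symm s r
  simp only [symbol, Matrix.conjTranspose_apply, Matrix.sub_apply, Matrix.add_apply,
    Matrix.sum_apply, Matrix.smul_apply, Matrix.map_apply, Matrix.transpose_apply, smul_eq_mul,
    star_sub, star_add, star_sum, star_mul', RCLike.star_def, Complex.conj_ofReal, Complex.conj_I,
    WeightedGraph.adjMatrix, Matrix.of_apply, hW]
  congr 1
  · rw [Matrix.one_apply, Matrix.one_apply]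
    by_cases h : s = r
    · simp [h]
    · simp [h, Ne.symm h]
  · congr 1
    refine Finset.sum_congr rfl fun k _ => Finset.sum_congr rfl fun α _ => ?_
    push_cast
    ring

end DiamondData

end Symbols

/-! ### Row sums of matrices -/

namespace Matrix

variable {N : Type*} [Fintype N]

/-- All absolute row sums of `M` are at most `c`. -/
def RowSumLE (M : Matrix N N ℂ) (c : ℝ) : Prop := ∀ u, ∑ v, ‖M u v‖ ≤ c

namespace RowSumLE

variable {A B : Matrix N N ℂ} {a b : ℝ}

theorem mono (hA : A.RowSumLE a) (h : a ≤ b) : A.RowSumLE b := fun u => (hA u).trans h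

theorem add (hA : A.RowSumLE a) (hB : B.RowSumLE b) : (A + B).RowSumLE (a + b) := fun u => by
  refine (Finset.sum_le_sum fun v _ => norm_add_le (A u v) (B u v)).trans ?_
  rw [Finset.sum_add_distrib]
  exact add_le_add (hA u) (hB u)

theorem of_norm_le (hB : B.RowSumLE b) {c : ℝ} (hc : 0 ≤ c) (h : ∀ u v, ‖A u v‖ ≤ c * ‖B u v‖) :
    A.RowSumLE (c * b) := fun u => by
  refine (Finset.sum_le_sum fun v _ => h u v).trans ?_
  rw [← Finset.mul_sum]
  exact mul_le_mul_of_nonneg_left (hB u) hc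

theorem sum_sum_norm_mul_le (hA : A.RowSumLE a) (hB : B.RowSumLE b) (hb : 0 ≤ b) (u : N) :
    ∑ w, ∑ v, ‖A u v‖ * ‖B v w‖ ≤ a * b := by
  rw [Finset.sum_comm]
  calc _ = ∑ v, ‖A u v‖ * ∑ w, ‖B v w‖ := by simp only [Finset.mul_sum]
    _ ≤ ∑ v, ‖A u v‖ * b :=
        Finset.sum_le_sum fun v _ => mul_le_mul_of_nonneg_left (hB v) (norm_nonneg _)
    _ ≤ a * b := by
        rw [← Finset.sum_mul]
        exact mul_le_mul_of_nonneg_right (hA u) hb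

theorem mul (hA : A.RowSumLE a) (hB : B.RowSumLE b) (hb : 0 ≤ b) : (A * B).RowSumLE (a * b) :=
  fun u => by
    refine le_trans (Finset.sum_le_sum fun w _ => ?_) (hA.sum_sum_norm_mul_le hB hb u)
    rw [mul_apply]
    exact (norm_sum_le _ _).trans_eq (Finset.sum_congr rfl fun v _ => norm_mul _ _)

theorem norm_apply_le (hA : A.RowSumLE a) (u v : N) : ‖A u v‖ ≤ a :=
  (Finset.single_le_sum (f := fun v => ‖A u v‖) (fun _ _ => norm_nonneg _)
    (Finset.mem_univ v)).trans (hA u)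

theorem norm_trace_le (hA : A.RowSumLE a) : ‖A.trace‖ ≤ Fintype.card N * a := by
  refine (norm_sum_le _ _).trans ?_
  rw [← nsmul_eq_mul]
  exact Finset.sum_le_card_nsmul _ _ _ fun u _ => hA.norm_apply_le u u

theorem frobSq_le (hA : A.RowSumLE a) : A.frobSq ≤ Fintype.card N * a ^ 2 := by
  rw [← nsmul_eq_mul]
  refine Finset.sum_le_card_nsmul _ _ _ fun u _ => ?_
  have h0 : 0 ≤ ∑ v, ‖A u v‖ := Finset.sum_nonneg fun _ _ => norm_nonneg _
  calc ∑ v, ‖A u v‖ ^ 2 ≤ (∑ v, ‖A u v‖) ^ 2 :=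
        Finset.sum_sq_le_sq_sum_of_nonneg fun _ _ => norm_nonneg _
    _ ≤ a ^ 2 := pow_le_pow_left₀ h0 (hA u) 2

/-- Gershgorin: the eigenvalue lies within the off-diagonal row sum of some diagonal entry. -/
theorem abs_eigenvalues_le [DecidableEq N] (hA : A.RowSumLE a) (h : A.IsHermitian) (i : N) :
    |h.eigenvalues i| ≤ a := by
  have h1 : Module.End.HasEigenvalue (Matrix.toLin' A) ((h.eigenvalues i : ℝ) : ℂ) := by
    rw [Module.End.hasEigenvalue_iff_mem_spectrum, Matrix.spectrum_toLin', h.spectrum_eq_image_range]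
    exact ⟨_, ⟨i, rfl⟩, rfl⟩
  obtain ⟨k, hk⟩ := eigenvalue_mem_ball h1
  rw [mem_closedBall_iff_norm] at hk
  have h2 := hA k
  rw [← Finset.add_sum_erase _ _ (Finset.mem_univ k)] at h2
  have h3 : ‖((h.eigenvalues i : ℝ) : ℂ)‖ ≤ ‖A k k‖ + ‖((h.eigenvalues i : ℝ) : ℂ) - A k k‖ := by
    have := norm_add_le (A k k) (((h.eigenvalues i : ℝ) : ℂ) - A k k)
    rwa [add_sub_cancel] at this
  rw [Complex.norm_real, Real.norm_eq_abs] at h3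
  linarith

end RowSumLE

end Matrix

/-! ### Neighbourhoods of grid nodes -/

section Neighbours

variable {d ν : ℕ}

theorem indexDiff_injective {n : Fin d → ℕ} (i : ∀ q, Fin (n q)) :
    Function.Injective (indexDiff i) := by
  intro j k h
  funext q
  have : ((i q : ℕ) : ℤ) - ((j q : ℕ) : ℤ) = ((i q : ℕ) : ℤ) - ((k q : ℕ) : ℤ) := congrFun h q
  exact Fin.ext (by omega)

theorem indexDiff_sub_indexDiff {n : Fin d → ℕ} (i j k : ∀ q, Fin (n q)) :
    indexDiff i k - indexDiff i j = indexDiff j k := by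
  funext q
  simp only [indexDiff, Pi.sub_apply]
  ring

theorem indexDiff_self {n : Fin d → ℕ} (i : ∀ q, Fin (n q)) : indexDiff i i = 0 := by
  funext q
  simp [indexDiff]

theorem indexDiff_eq_zero_iff {n : Fin d → ℕ} (i j : ∀ q, Fin (n q)) :
    indexDiff i j = 0 ↔ i = j := by
  rw [← indexDiff_self i, (indexDiff_injective i).eq_iff, eq_comm]

theorem exists_forall_natAbs_le (S : Finset (Fin d → ℤ)) :
    ∃ R : ℕ, ∀ η ∈ S, ∀ q, (η q).natAbs ≤ R :=
  ⟨S.sup fun η => Finset.univ.sup fun q => (η q).natAbs, fun η hη q =>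
    (Finset.le_sup (f := fun q => (η q).natAbs) (Finset.mem_univ q)).trans
      (Finset.le_sup (f := fun η : Fin d → ℤ => Finset.univ.sup fun q => (η q).natAbs) hη)⟩

variable [NeZero d]

/-- If the indices differ by at most `R` in each direction, the closed cells containing the two
nodes keep them within `(R + 1) / n_q` there. -/
theorem eventually_dist_immersion_lt (S : Finset (Fin d → ℤ)) {δ : ℝ} (hδ : 0 < δ) :
    ∀ᶠ n : Fin d → ℕ in atTop, ∀ u v : DiamondNode n ν, indexDiff u.1 v.1 ∈ S →
      dist (immersion n u) (immersion n v) < δ := by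
  obtain ⟨R, hR⟩ := exists_forall_natAbs_le S
  filter_upwards [eventually_forall_lt_atTop (d := d) ((R + 1) / δ)] with n hn u v huv
  refine (dist_pi_lt_iff hδ).2 fun q => ?_
  have hq : 0 < (n q : ℝ) := lt_trans' (hn q) (by positivity)
  have h1 := immersion_mem_Icc n u q
  have h2 := immersion_mem_Icc n v q
  have h3 : (R + 1 : ℝ) / n q < δ := by
    rw [div_lt_iff₀ hq, mul_comm]
    exact (div_lt_iff₀ hδ).1 (hn q)
  have h4 := hR _ huv q
  have h5 : ((u.1 q : ℕ) : ℤ) - ((v.1 q : ℕ) : ℤ) ≤ R ∧ ((v.1 q : ℕ) : ℤ) - ((u.1 q : ℕ) : ℤ) ≤ R := by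
    simp only [indexDiff] at h4
    omega
  have h6 : ((u.1 q : ℕ) : ℝ) - ((v.1 q : ℕ) : ℝ) ≤ R := by exact_mod_cast h5.1
  have h7 : ((v.1 q : ℕ) : ℝ) - ((u.1 q : ℕ) : ℝ) ≤ R := by exact_mod_cast h5.2
  have h8 : (((u.1 q : ℕ) : ℝ) + 1) / n q - ((v.1 q : ℕ) : ℝ) / n q ≤ (R + 1) / n q := by
    rw [← sub_div]
    gcongr
    linarith
  have h9 : (((v.1 q : ℕ) : ℝ) + 1) / n q - ((u.1 q : ℕ) : ℝ) / n q ≤ (R + 1) / n q := by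
    rw [← sub_div]
    gcongr
    linarith
  rw [Real.dist_eq, abs_lt]
  constructor <;> linarith [h1.1, h1.2, h2.1, h2.2]

/-- For nodes in a compact subset of an open part of the cube all neighbours exist. -/
theorem eventually_exists_neighbour {K U : Set (Fin d → ℝ)} (hK : IsCompact K) (hU : IsOpen U)
    (hKU : K ⊆ U) (hU1 : U ⊆ Set.Icc 0 1) (S : Finset (Fin d → ℤ)) :
    ∀ᶠ n : Fin d → ℕ in atTop, ∀ u : DiamondNode n ν, immersion n u ∈ K → ∀ η ∈ S, ∀ t : Fin ν,
      ∃ j : ∀ q, Fin (n q), indexDiff u.1 j = η ∧ immersion n (j, t) ∈ U := by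
  obtain ⟨δ, hδ, hδU⟩ := hK.exists_thickening_subset_open hU hKU
  obtain ⟨R, hR⟩ := exists_forall_natAbs_le S
  filter_upwards [eventually_dist_immersion_lt (ν := ν) S hδ,
    eventually_forall_lt_atTop (d := d) ((R + 1) / (δ / 2))] with n hd hn u hu η hη t
  have hj : ∀ q, 0 ≤ ((u.1 q : ℕ) : ℤ) - η q ∧ ((u.1 q : ℕ) : ℤ) - η q < n q := by
    intro q
    have hq : 0 < (n q : ℝ) := lt_trans' (hn q) (by positivity)
    -- Shifts by `δ / 2` along an axis stay in `U`, hence in the cube. The node is thus `δ / 2` away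
    -- from the faces, which for large `n` leaves more than `R` indices on either side.
    have hball : ∀ s : ℝ, |s| ≤ δ / 2 →
        immersion n u q + s ∈ Set.Icc (0 : ℝ) 1 := by
      intro s hs
      have h1 : immersion n u + Pi.single q s ∈ U := by
        refine hδU (Metric.mem_thickening_iff.2 ⟨_, hu, ?_⟩)
        rw [dist_eq_norm, add_sub_cancel_left, Pi.norm_single, Real.norm_eq_abs]
        linarith
      have h2 := hU1 h1
      have h3 := h2.1 q
      have h4 := h2.2 q
      simp only [Pi.add_apply, Pi.single_eq_same] at h3 h4
      exact ⟨h3, h4⟩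
    have ha : |δ / 2| ≤ δ / 2 := (abs_of_pos (by positivity)).le
    have h1 := (hball (δ / 2) ha).2
    have h2 := (hball (-(δ / 2)) (by rwa [abs_neg])).1
    have h3 := immersion_mem_Icc n u q
    have h4 : (R + 1 : ℝ) < δ / 2 * n q := by
      rw [mul_comm]
      exact (div_lt_iff₀ (by positivity)).1 (hn q)
    have h5 : δ / 2 * n q ≤ ((u.1 q : ℕ) : ℝ) + 1 := by
      rw [← le_div_iff₀ hq]
      linarith [h3.2]
    have h6 : ((u.1 q : ℕ) : ℝ) ≤ (1 - δ / 2) * n q := by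
      rw [← div_le_iff₀ hq]
      linarith [h3.1]
    have h7 : (R : ℝ) < ((u.1 q : ℕ) : ℝ) := by linarith
    have h8 : ((u.1 q : ℕ) : ℝ) + R + 1 < n q := by nlinarith
    have h9 := hR η hη q
    have h7' : R < (u.1 q : ℕ) := by exact_mod_cast h7
    have h8' : (u.1 q : ℕ) + R + 1 < n q := by exact_mod_cast h8
    omega
  have hη' : indexDiff u.1 (fun q => (⟨(((u.1 q : ℕ) : ℤ) - η q).toNat, by
      have := hj q; omega⟩ : Fin (n q))) = η := by
    funext q
    have := hj q
    simp only [indexDiff]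
    omega
  refine ⟨_, hη', ?_⟩
  refine hδU (Metric.mem_thickening_iff.2 ⟨_, hu, ?_⟩)
  rw [dist_comm]
  refine hd u _ ?_
  dsimp only
  rw [hη']
  exact hη

variable {Ω : Set (Fin d → ℝ)} {n : Fin d → ℕ}

/-- For fixed `u`, a node `v` is determined by its offset from `u` and its index in the diamond, so
the sum runs over part of `S × Fin ν`. -/
theorem sum_neighbours_le (S : Finset (Fin d → ℤ)) (u : GridNode Ω n ν)
    {β : (Fin d → ℤ) → Fin ν → ℝ} (h0 : ∀ η t, 0 ≤ β η t) (hS : ∀ η, η ∉ S → ∀ t, β η t = 0) :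
    ∑ v : GridNode Ω n ν, β (indexDiff u.1.1 v.1.1) v.1.2 ≤ ∑ η ∈ S, ∑ t, β η t := by
  classical
  rw [← Finset.sum_product', ← Finset.sum_filter_of_ne
    (p := fun v : GridNode Ω n ν => indexDiff u.1.1 v.1.1 ∈ S)]
  · rw [← Finset.sum_image (f := fun p : (Fin d → ℤ) × Fin ν => β p.1 p.2)
      (g := fun v : GridNode Ω n ν => (indexDiff u.1.1 v.1.1, v.1.2))]
    · refine Finset.sum_le_sum_of_subset_of_nonneg ?_ fun p _ _ => h0 _ _
      intro p hp
      obtain ⟨v, hv, rfl⟩ := Finset.mem_image.1 hp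
      exact Finset.mem_product.2 ⟨(Finset.mem_filter.1 hv).2, Finset.mem_univ _⟩
    · intro v _ w _ hvw
      have h := Prod.mk.inj hvw
      exact Subtype.ext (Prod.ext (indexDiff_injective _ h.1) h.2)
  · intro v _ hv
    by_contra h
    exact hv (hS _ h _)

/-- When no neighbour is cut off by `Ω`, the injection behind `sum_neighbours_le` is onto `S × Fin
ν`. -/
theorem sum_neighbours_eq (S : Finset (Fin d → ℤ)) (u : GridNode Ω n ν)
    {β : (Fin d → ℤ) → Fin ν → ℂ} (hS : ∀ η, η ∉ S → ∀ t, β η t = 0)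
    (hu : ∀ η ∈ S, ∀ t : Fin ν, ∃ j : ∀ q, Fin (n q), indexDiff u.1.1 j = η ∧
      immersion n (j, t) ∈ Ω) :
    ∑ v : GridNode Ω n ν, β (indexDiff u.1.1 v.1.1) v.1.2 = ∑ η ∈ S, ∑ t, β η t := by
  classical
  rw [← Finset.sum_product', ← Finset.sum_filter_of_ne
    (p := fun v : GridNode Ω n ν => indexDiff u.1.1 v.1.1 ∈ S)]
  · refine Finset.sum_bij (fun v _ => (indexDiff u.1.1 v.1.1, v.1.2)) ?_ ?_ ?_ fun _ _ => rfl
    · intro v hv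
      exact Finset.mem_product.2 ⟨(Finset.mem_filter.1 hv).2, Finset.mem_univ _⟩
    · intro v _ w _ hvw
      have h := Prod.mk.inj hvw
      exact Subtype.ext (Prod.ext (indexDiff_injective _ h.1) h.2)
    · rintro ⟨η, t⟩ hp
      have hη := (Finset.mem_product.1 hp).1
      obtain ⟨j, hj, hjΩ⟩ := hu η hη t
      subst hj
      exact ⟨⟨(j, t), hjΩ⟩, Finset.mem_filter.2 ⟨Finset.mem_univ _, hη⟩, rfl⟩
  · intro v _ hv
    by_contra h
    exact hv (hS _ h _)

end Neighbours

/-! ### Sampled Toeplitz matrices and their moments -/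

section LocallyToeplitz

variable {d ν : ℕ}

namespace TrigPoly

/-- The sum of the absolute values of all entries of all coefficients. -/
noncomputable def coeffNorm (b : TrigPoly d ν) : ℝ :=
  ∑ η ∈ b.coeff.support, ∑ r, ∑ t, ‖b.coeff η r t‖

theorem coeffNorm_nonneg (b : TrigPoly d ν) : 0 ≤ coeffNorm b :=
  Finset.sum_nonneg fun _ _ => Finset.sum_nonneg fun _ _ => Finset.sum_nonneg fun _ _ =>
    norm_nonneg _

theorem coeff_eq_zero {b : TrigPoly d ν} {η : Fin d → ℤ} (h : η ∉ b.coeff.support) (r t : Fin ν) :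
    b.coeff η r t = 0 := by
  rw [Finsupp.notMem_support_iff.1 h, Matrix.zero_apply]

theorem sum_norm_coeff_row_le (b : TrigPoly d ν) (r : Fin ν) :
    ∑ η ∈ b.coeff.support, ∑ t, ‖b.coeff η r t‖ ≤ coeffNorm b :=
  Finset.sum_le_sum fun η _ => Finset.single_le_sum (f := fun r => ∑ t, ‖b.coeff η r t‖)
    (fun _ _ => Finset.sum_nonneg fun _ _ => norm_nonneg _) (Finset.mem_univ r)

theorem norm_expChar (θ : Fin d → ℝ) (δ : Fin d → ℤ) : ‖expChar θ δ‖ = 1 :=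
  Complex.norm_exp_ofReal_mul_I _

theorem rowSumLE_evalTrig (b : TrigPoly d ν) (θ : Fin d → ℝ) :
    (evalTrig θ b).RowSumLE (coeffNorm b) := by
  intro r
  refine le_trans ?_ (sum_norm_coeff_row_le b r)
  rw [Finset.sum_comm]
  refine Finset.sum_le_sum fun t _ => ?_
  rw [evalTrig_eq_sum, Matrix.sum_apply]
  refine (norm_sum_le _ _).trans (Finset.sum_le_sum fun η _ => ?_)
  rw [Matrix.smul_apply, norm_smul, norm_expChar, one_mul]

theorem coeff_mul_apply (b B : TrigPoly d ν) (δ : Fin d → ℤ) (r s : Fin ν) :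
    (b * B).coeff δ r s =
      ∑ η ∈ b.coeff.support, ∑ t, b.coeff η r t * B.coeff (δ - η) t s := by
  rw [AddMonoidAlgebra.coeff_mul_apply_left, Finsupp.sum, Matrix.sum_apply]
  refine Finset.sum_congr rfl fun η _ => ?_
  rw [Matrix.mul_apply, neg_add_eq_sub]

end TrigPoly

open TrigPoly

variable [NeZero d]

/-- The Toeplitz matrix with coefficients `b` on the grid nodes, sampled with `φ` at midpoints. -/
noncomputable def midSampled (Ω : Set (Fin d → ℝ)) (n : Fin d → ℕ) (φ : (Fin d → ℝ) → ℝ)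
    (b : TrigPoly d ν) : Matrix (GridNode Ω n ν) (GridNode Ω n ν) ℂ :=
  Matrix.of fun u v => (φ ((1 / 2 : ℝ) • (immersion n u.1 + immersion n v.1)) : ℂ) *
    b.coeff (indexDiff u.1.1 v.1.1) u.1.2 v.1.2

/-- The Toeplitz matrix with coefficients `b` on the grid nodes, sampled with `φ` at row nodes. -/
noncomputable def rowSampled (Ω : Set (Fin d → ℝ)) (n : Fin d → ℕ) (φ : (Fin d → ℝ) → ℝ)
    (b : TrigPoly d ν) : Matrix (GridNode Ω n ν) (GridNode Ω n ν) ℂ :=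
  Matrix.of fun u v => (φ (immersion n u.1) : ℂ) *
    b.coeff (indexDiff u.1.1 v.1.1) u.1.2 v.1.2

variable {Ω : Set (Fin d → ℝ)} {n : Fin d → ℕ} {φ : (Fin d → ℝ) → ℝ} {b : TrigPoly d ν}

/-- Each row meets each coefficient entry at most once, so the bound is uniform in `n`. -/
theorem rowSumLE_rowSampled_one : (rowSampled Ω n (fun _ => 1) b).RowSumLE (coeffNorm b) := by
  intro u
  refine le_trans (le_of_eq ?_) ((sum_neighbours_le b.coeff.support u
    (β := fun η t => ‖b.coeff η u.1.2 t‖) (fun _ _ => norm_nonneg _)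
    fun η h t => by rw [coeff_eq_zero h, norm_zero]).trans (sum_norm_coeff_row_le b u.1.2))
  simp [rowSampled]

theorem rowSumLE_of_norm_le {A : Matrix (GridNode Ω n ν) (GridNode Ω n ν) ℂ} {c : ℝ} (hc : 0 ≤ c)
    (h : ∀ u v, ‖A u v‖ ≤ c * ‖b.coeff (indexDiff u.1.1 v.1.1) u.1.2 v.1.2‖) :
    A.RowSumLE (c * coeffNorm b) :=
  rowSumLE_rowSampled_one.of_norm_le hc fun u v => by simpa [rowSampled] using h u v

theorem rowSumLE_midSampled {C : ℝ} (hC : ∀ x, |φ x| ≤ C) :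
    (midSampled Ω n φ b).RowSumLE (C * coeffNorm b) :=
  rowSumLE_of_norm_le ((abs_nonneg _).trans (hC 0)) fun u v => by
    rw [midSampled, Matrix.of_apply, norm_mul, Complex.norm_real]
    exact mul_le_mul_of_nonneg_right (hC _) (norm_nonneg _)

theorem rowSampled_one_one : rowSampled Ω n (fun _ => 1) (1 : TrigPoly d ν) = 1 := by
  ext u v
  rw [rowSampled, Matrix.of_apply, Complex.ofReal_one, one_mul, AddMonoidAlgebra.one_def,
    AddMonoidAlgebra.coeff_single, Finsupp.single_apply]
  by_cases h : u = v
  · subst h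
    rw [indexDiff_self, if_pos rfl, Matrix.one_apply_eq, Matrix.one_apply_eq]
  · rw [Matrix.one_apply_ne h]
    split_ifs with h1
    · refine Matrix.one_apply_ne fun h2 => h (Subtype.ext (Prod.ext ?_ h2))
      exact (indexDiff_eq_zero_iff _ _).1 h1.symm
    · rfl

/-- Multiplication of locally Toeplitz matrices, up to a matrix with small row sums. -/
theorem eventually_rowSumLE_mul (hΩ : Ω ⊆ Set.Icc 0 1) (hφ : Continuous φ)
    (hc : HasCompactSupport φ) (hs : tsupport φ ⊆ interior Ω) (k : ℕ) (b B : TrigPoly d ν) {ε : ℝ}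
    (hε : 0 < ε) :
    ∀ᶠ n : Fin d → ℕ in atTop,
      (midSampled Ω n φ b * rowSampled Ω n (fun x => φ x ^ k) B -
        rowSampled Ω n (fun x => φ x ^ (k + 1)) (b * B)).RowSumLE ε := by
  set ω : ℝ := ε / (coeffNorm b * coeffNorm B + 1) with hω
  have hb0 := coeffNorm_nonneg b
  have hB0 := coeffNorm_nonneg B
  have hω0 : 0 < ω := by positivity
  -- The weight that the product puts on a path from `u` through `v`. At `v = u` it is `φ(x_u) ^ (k
  -- + 1)`, and uniform continuity makes the error at most `ω` for linked nodes.
  have hG : Continuous fun z : (Fin d → ℝ) × (Fin d → ℝ) =>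
      φ ((1 / 2 : ℝ) • (z.1 + z.2)) * φ z.2 ^ k := by fun_prop
  obtain ⟨δ, hδ, hδω⟩ := Metric.uniformContinuousOn_iff.1
    (((isCompact_Icc (a := (0 : Fin d → ℝ)) (b := 1)).prod
      (isCompact_Icc (a := (0 : Fin d → ℝ)) (b := 1))).uniformContinuousOn_of_continuous
      hG.continuousOn) ω hω0
  filter_upwards [eventually_dist_immersion_lt (ν := ν) b.coeff.support hδ,
    eventually_exists_neighbour (ν := ν) hc.isCompact isOpen_interior hs
      (interior_subset.trans hΩ) b.coeff.support] with n hd hn u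
  have hentry : ∀ w : GridNode Ω n ν,
      ‖(midSampled Ω n φ b * rowSampled Ω n (fun x => φ x ^ k) B -
        rowSampled Ω n (fun x => φ x ^ (k + 1)) (b * B)) u w‖ ≤
      ω * ∑ v, ‖rowSampled Ω n (fun _ => 1) b u v‖ * ‖rowSampled Ω n (fun _ => 1) B v w‖ := by
    intro w
    have h1 : rowSampled Ω n (fun x => φ x ^ (k + 1)) (b * B) u w =
        ∑ v : GridNode Ω n ν, ((φ (immersion n u.1) ^ (k + 1) : ℝ) : ℂ) *
          (b.coeff (indexDiff u.1.1 v.1.1) u.1.2 v.1.2 *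
            B.coeff (indexDiff v.1.1 w.1.1) v.1.2 w.1.2) := by
      rw [rowSampled, Matrix.of_apply, ← Finset.mul_sum]
      -- If the row weight vanishes there is nothing to prove. Otherwise the node lies in the
      -- support of `φ`, all its neighbours are in `Ω`, and the convolution is complete.
      by_cases h0 : φ (immersion n u.1) = 0
      · rw [h0, zero_pow k.succ_ne_zero, Complex.ofReal_zero, zero_mul, zero_mul]
      · congr 1
        rw [coeff_mul_apply, ← sum_neighbours_eq b.coeff.support u
          (β := fun η t => b.coeff η u.1.2 t * B.coeff (indexDiff u.1.1 w.1.1 - η) t w.1.2)]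
        · simp only [indexDiff_sub_indexDiff]
        · intro η h t
          rw [coeff_eq_zero h, zero_mul]
        · intro η hη t
          obtain ⟨j, hj, hjΩ⟩ := hn u.1 (subset_tsupport φ h0) η hη t
          exact ⟨j, hj, interior_subset hjΩ⟩
    rw [Matrix.sub_apply, h1, Matrix.mul_apply, ← Finset.sum_sub_distrib, Finset.mul_sum]
    refine (norm_sum_le _ _).trans (Finset.sum_le_sum fun v _ => ?_)
    by_cases hv : indexDiff u.1.1 v.1.1 ∈ b.coeff.support
    · have h2 : ‖((φ ((1 / 2 : ℝ) • (immersion n u.1 + immersion n v.1)) *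
          φ (immersion n v.1) ^ k - φ (immersion n u.1) ^ (k + 1) : ℝ) : ℂ)‖ ≤ ω := by
        have h3 := hδω (immersion n u.1, immersion n v.1) ⟨hΩ u.2, hΩ v.2⟩
          (immersion n u.1, immersion n u.1) ⟨hΩ u.2, hΩ u.2⟩ (by
            rw [Prod.dist_eq, dist_self, dist_comm]
            exact max_lt hδ (hd u.1 v.1 hv))
        have h4 : (1 / 2 : ℝ) • (immersion n u.1 + immersion n u.1) = immersion n u.1 := by
          rw [← two_smul ℝ, smul_smul]
          norm_num
        dsimp only at h3
        rw [h4, ← pow_succ', Real.dist_eq] at h3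
        rw [Complex.norm_real]
        exact h3.le
      refine le_trans (le_of_eq ?_) (mul_le_mul_of_nonneg_right h2
        (mul_nonneg (norm_nonneg _) (norm_nonneg _)))
      rw [← norm_mul, ← norm_mul]
      simp only [midSampled, rowSampled, Matrix.of_apply]
      congr 1
      push_cast
      ring
    · simp only [midSampled, rowSampled, Matrix.of_apply, coeff_eq_zero hv]
      simp
  refine (Finset.sum_le_sum fun w _ => hentry w).trans ?_
  rw [← Finset.mul_sum]
  refine (mul_le_mul_of_nonneg_left (rowSumLE_rowSampled_one.sum_sum_norm_mul_le
    rowSumLE_rowSampled_one hB0 u) hω0.le).trans ?_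
  rw [hω, div_mul_eq_mul_div, div_le_iff₀ (by positivity)]
  nlinarith

/-- Powers of locally Toeplitz matrices, up to a matrix with small row sums. -/
theorem eventually_rowSumLE_pow (hΩ : Ω ⊆ Set.Icc 0 1) (hφ : Continuous φ)
    (hc : HasCompactSupport φ) (hs : tsupport φ ⊆ interior Ω) (b : TrigPoly d ν) (k : ℕ) :
    ∀ ε : ℝ, 0 < ε → ∀ᶠ n : Fin d → ℕ in atTop,
      (midSampled Ω n φ b ^ k - rowSampled Ω n (fun x => φ x ^ k) (b ^ k)).RowSumLE ε := by
  obtain ⟨C, hC⟩ := hc.exists_bound_of_continuous hφ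
  have hC0 : 0 ≤ C := (norm_nonneg _).trans (hC 0)
  have hb0 := coeffNorm_nonneg b
  induction k with
  | zero =>
    intro ε hε
    refine Eventually.of_forall fun n u => ?_
    simp only [pow_zero, rowSampled_one_one, sub_self, Matrix.zero_apply, norm_zero,
      Finset.sum_const_zero]
    exact hε.le
  | succ k ih =>
    intro ε hε
    filter_upwards [ih (ε / 2 / (C * coeffNorm b + 1)) (by positivity),
      eventually_rowSumLE_mul hΩ hφ hc hs k b (b ^ k) (half_pos hε)] with n h1 h2
    -- The inductive error is multiplied by a matrix of bounded row sums, and one new multiplication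
    -- error is added.
    have h3 : midSampled Ω n φ b ^ (k + 1) - rowSampled Ω n (fun x => φ x ^ (k + 1)) (b ^ (k + 1)) =
        midSampled Ω n φ b * (midSampled Ω n φ b ^ k - rowSampled Ω n (fun x => φ x ^ k) (b ^ k)) +
        (midSampled Ω n φ b * rowSampled Ω n (fun x => φ x ^ k) (b ^ k) -
          rowSampled Ω n (fun x => φ x ^ (k + 1)) (b * b ^ k)) := by
      rw [pow_succ', pow_succ' b, mul_sub]
      abel
    rw [h3]
    refine (((rowSumLE_midSampled hC).mul h1 (by positivity)).add h2).mono ?_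
    have h4 : C * coeffNorm b * (ε / 2 / (C * coeffNorm b + 1)) ≤ ε / 2 := by
      rw [mul_div_assoc', div_le_iff₀ (by positivity)]
      nlinarith [mul_nonneg hC0 hb0]
    linarith

/-! ### Sums over the nodes in a regular domain -/

theorem sum_gridNode (Ω : Set (Fin d → ℝ)) (n : Fin d → ℕ) (g : DiamondNode n ν → ℂ) :
    ∑ u : GridNode Ω n ν, g u.1 =
      ∑ r, ∑ i, Ω.indicator (fun _ => (1 : ℂ)) (immersion n (i, r)) * g (i, r) := by
  classical
  rw [← Finset.sum_product_right', Finset.univ_product_univ]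
  rw [← Finset.sum_subtype (Finset.univ.filter fun v : DiamondNode n ν => immersion n v ∈ Ω)
    (by simp) g, Finset.sum_filter]
  refine Finset.sum_congr rfl fun v _ => ?_
  by_cases h : immersion n v ∈ Ω
  · rw [if_pos h, Set.indicator_of_mem h, one_mul]
  · rw [if_neg h, Set.indicator_of_notMem h, zero_mul]

/-- `Ω.indicator ψ` is continuous off `frontier Ω`, which is null, so the Riemann sums over the
whole cube converge. -/
theorem tendsto_sum_gridNode (hΩ : IsRegularDomain Ω) {ψ : (Fin d → ℝ) → ℝ} (hψ : Continuous ψ)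
    {K : ℝ} (hK : ∀ x, |ψ x| ≤ K) (β : Fin ν → ℂ) :
    Tendsto (fun n : Fin d → ℕ => (∏ q, (n q : ℂ))⁻¹ *
      ∑ u : GridNode Ω n ν, (ψ (immersion n u.1) : ℂ) * β u.1.2) atTop
      (𝓝 (((∫ x in Ω, ψ x : ℝ) : ℂ) * ∑ r, β r)) := by
  have hK0 : 0 ≤ K := (abs_nonneg _).trans (hK 0)
  have hlim : ∀ r : Fin ν, Tendsto (fun n : Fin d → ℕ =>
      (∏ q, (n q : ℝ))⁻¹ * ∑ i, Ω.indicator ψ (immersion n (i, r))) atTop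
      (𝓝 (∫ x in Ω, ψ x)) := by
    intro r
    have h1 := tendsto_riemannSum r (ψ := Ω.indicator ψ) (K := K) (fun x => by
        by_cases h : x ∈ Ω
        · rw [Set.indicator_of_mem h]; exact hK x
        · rw [Set.indicator_of_notMem h, abs_zero]; exact hK0) (by
        have h2 : ∀ᵐ x : Fin d → ℝ, x ∉ frontier Ω := measure_eq_zero_iff_ae_notMem.1 hΩ.volume_frontier
        filter_upwards [h2] with x hx _
        by_cases h : x ∈ interior Ω
        · refine hψ.continuousAt.congr ?_
          filter_upwards [mem_interior_iff_mem_nhds.1 h] with y hy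
          rw [Set.indicator_of_mem hy]
        · have h3 : x ∉ closure Ω := fun h3 => hx ⟨h3, h⟩
          refine (continuousAt_const (y := (0 : ℝ))).congr ?_
          filter_upwards [isClosed_closure.isOpen_compl.mem_nhds h3] with y hy
          rw [Set.indicator_of_notMem fun h => hy (subset_closure h)])
    rw [setIntegral_eq_integral_of_forall_compl_eq_zero fun x hx =>
      Set.indicator_of_notMem (fun h => hx (hΩ.subset_cube h)) _,
      integral_indicator₀ hΩ.nullMeasurable] at h1
    exact h1
  have h1 : Tendsto (fun n : Fin d → ℕ => ∑ r, (((∏ q, (n q : ℝ))⁻¹ *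
      ∑ i, Ω.indicator ψ (immersion n (i, r)) : ℝ) : ℂ) * β r) atTop
      (𝓝 (∑ r, ((∫ x in Ω, ψ x : ℝ) : ℂ) * β r)) :=
    tendsto_finsetSum _ fun r _ =>
      ((Complex.continuous_ofReal.tendsto _).comp (hlim r)).mul_const _
  rw [Finset.mul_sum]
  refine h1.congr fun n => ?_
  rw [sum_gridNode Ω n fun v => (ψ (immersion n v) : ℂ) * β v.2, Finset.mul_sum]
  refine Finset.sum_congr rfl fun r _ => ?_
  push_cast
  rw [mul_assoc, Finset.sum_mul]
  congr 1
  refine Finset.sum_congr rfl fun i _ => ?_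
  by_cases h : immersion n (i, r) ∈ Ω
  · rw [Set.indicator_of_mem h, Set.indicator_of_mem h, one_mul]
  · rw [Set.indicator_of_notMem h, Set.indicator_of_notMem h]
    simp

omit [NeZero d] in
theorem IsRegularDomain.volume_lt_top (hΩ : IsRegularDomain Ω) : volume Ω < ⊤ :=
  (measure_mono hΩ.subset_cube).trans_lt measure_Icc_lt_top

omit [NeZero d] in
theorem IsRegularDomain.volume_real_pos (hΩ : IsRegularDomain Ω) : 0 < volume.real Ω :=
  ENNReal.toReal_pos hΩ.volume_pos.ne' hΩ.volume_lt_top.ne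

theorem tendsto_card_gridNode (hΩ : IsRegularDomain Ω) :
    Tendsto (fun n : Fin d → ℕ => (∏ q, (n q : ℂ))⁻¹ * Fintype.card (GridNode Ω n ν)) atTop
      (𝓝 ((volume.real Ω : ℂ) * ν)) := by
  have h := tendsto_sum_gridNode (ν := ν) hΩ (ψ := fun _ => 1) continuous_const (K := 1)
    (fun _ => by simp) (fun _ => 1)
  simpa using h

/-- Means over the nodes tend to means over the domain. -/
theorem tendsto_mean_gridNode [NeZero ν] (hΩ : IsRegularDomain Ω) {ψ : (Fin d → ℝ) → ℝ}
    (hψ : Continuous ψ) {K : ℝ} (hK : ∀ x, |ψ x| ≤ K) (β : Fin ν → ℂ) :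
    Tendsto (fun n : Fin d → ℕ => (1 / (Fintype.card (GridNode Ω n ν) : ℂ)) *
      ∑ u : GridNode Ω n ν, (ψ (immersion n u.1) : ℂ) * β u.1.2) atTop
      (𝓝 ((1 / ((volume.real Ω : ℂ) * ν)) * (((∫ x in Ω, ψ x : ℝ) : ℂ) * ∑ r, β r))) := by
  have hne : (volume.real Ω : ℂ) * ν ≠ 0 :=
    mul_ne_zero (by exact_mod_cast hΩ.volume_real_pos.ne') (by exact_mod_cast NeZero.ne ν)
  have h := (tendsto_sum_gridNode hΩ hψ hK β).div (tendsto_card_gridNode (ν := ν) hΩ) hne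
  rw [one_div_mul_eq_div]
  refine h.congr' ?_
  filter_upwards [eventually_forall_lt_atTop (d := d) 0] with n hn
  have hn' : (∏ q, (n q : ℂ)) ≠ 0 := Finset.prod_ne_zero_iff.2 fun q _ => by
    have := hn q
    exact_mod_cast this.ne'
  simp only [Pi.div_apply]
  rw [mul_div_mul_left _ _ (inv_ne_zero hn'), one_div_mul_eq_div]

theorem tendsto_card_gridNode_atTop [NeZero ν] (hΩ : IsRegularDomain Ω) :
    Tendsto (fun n : Fin d → ℕ => Fintype.card (GridNode Ω n ν)) atTop atTop := by
  have h1 : Tendsto (fun n : Fin d → ℕ => (∏ q, (n q : ℝ))⁻¹ * Fintype.card (GridNode Ω n ν)) atTop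
      (𝓝 (volume.real Ω * ν)) := by
    have := (Complex.continuous_re.tendsto _).comp (tendsto_card_gridNode (ν := ν) hΩ)
    rw [← Complex.ofReal_natCast, ← Complex.ofReal_mul, Complex.ofReal_re] at this
    refine this.congr fun n => ?_
    simp only [Function.comp_apply]
    rw [← Complex.ofReal_re ((∏ q, (n q : ℝ))⁻¹ * Fintype.card (GridNode Ω n ν))]
    push_cast
    rfl
  have hpos : 0 < volume.real Ω * ν :=
    mul_pos hΩ.volume_real_pos (by exact_mod_cast NeZero.pos ν)
  have h2 : Tendsto (fun n : Fin d → ℕ => ∏ q, (n q : ℝ)) atTop atTop := by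
    refine tendsto_atTop_mono' _ ?_
      (tendsto_natCast_atTop_atTop.comp (tendsto_eval_pi_atTop (0 : Fin d)))
    filter_upwards [eventually_forall_lt_atTop (d := d) 0] with n hn
    have hn1 : ∀ q, 1 ≤ n q := fun q => by
      have := hn q
      exact_mod_cast this
    simp only [Function.comp_apply]
    rw [← Nat.cast_prod]
    exact_mod_cast Finset.single_le_prod' (f := n) (fun q _ => hn1 q) (Finset.mem_univ 0)
  rw [← tendsto_natCast_atTop_iff (R := ℝ)]
  refine (h2.atTop_mul_pos hpos h1).congr' ?_
  filter_upwards [eventually_forall_lt_atTop (d := d) 0] with n hn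
  have hn' : (∏ q, (n q : ℝ)) ≠ 0 := Finset.prod_ne_zero_iff.2 fun q _ => (hn q).ne'
  rw [← mul_assoc, mul_inv_cancel₀ hn', one_mul]

/-- The moments of locally Toeplitz matrices. -/
theorem tendsto_mean_trace_pow [NeZero ν] (hΩ : IsRegularDomain Ω) (hφ : Continuous φ)
    (hc : HasCompactSupport φ) (hs : tsupport φ ⊆ interior Ω) (b : TrigPoly d ν) (k : ℕ) :
    Tendsto (fun n : Fin d → ℕ => (1 / (Fintype.card (GridNode Ω n ν) : ℂ)) *
      (midSampled Ω n φ b ^ k).trace) atTop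
      (𝓝 ((1 / ((volume.real Ω : ℂ) * ν)) *
        (((∫ x in Ω, φ x ^ k : ℝ) : ℂ) * ((b ^ k).coeff 0).trace))) := by
  obtain ⟨C, hC⟩ := hc.exists_bound_of_continuous hφ
  have h1 := tendsto_mean_gridNode hΩ (ψ := fun x => φ x ^ k) (hφ.pow k) (K := C ^ k)
    (fun x => by rw [abs_pow]; exact pow_le_pow_left₀ (abs_nonneg _) (hC x) k)
    (fun r => (b ^ k).coeff 0 r r)
  have h2 : Tendsto (fun n : Fin d → ℕ => (1 / (Fintype.card (GridNode Ω n ν) : ℂ)) *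
      (midSampled Ω n φ b ^ k - rowSampled Ω n (fun x => φ x ^ k) (b ^ k)).trace) atTop (𝓝 0) := by
    rw [Metric.tendsto_nhds]
    intro ε hε
    filter_upwards [eventually_rowSumLE_pow hΩ.subset_cube hφ hc hs b k (ε / 2) (half_pos hε)]
      with n hn
    rw [dist_zero_right, norm_mul, norm_div, norm_one, Complex.norm_natCast]
    refine lt_of_le_of_lt ?_ (half_lt_self hε)
    rw [one_div_mul_eq_div]
    refine div_le_of_le_mul₀ (Nat.cast_nonneg _) (half_pos hε).le ?_
    rw [mul_comm]
    exact hn.norm_trace_le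
  have h3 := h2.add h1
  rw [zero_add] at h3
  refine h3.congr fun n => ?_
  rw [Matrix.trace_sub, mul_sub]
  -- On the diagonal the offset is zero, so only the constant term of `b ^ k` is seen.
  have h4 : (rowSampled Ω n (fun x => φ x ^ k) (b ^ k)).trace =
      ∑ u : GridNode Ω n ν, ((φ (immersion n u.1) ^ k : ℝ) : ℂ) * (b ^ k).coeff 0 u.1.2 u.1.2 := by
    simp only [Matrix.trace, Matrix.diag_apply, rowSampled, Matrix.of_apply, indexDiff_self]
  rw [h4, sub_add_cancel]

end LocallyToeplitz

/-! ### Eigenvalue sums of continuous and polynomial functions -/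

theorem exists_complex_polynomial_near {F : ℂ → ℂ} (hF : Continuous F) (C : ℝ) {ε : ℝ}
    (hε : 0 < ε) : ∃ q : Polynomial ℂ, ∀ x : ℝ, |x| ≤ C → ‖F x - q.eval (x : ℂ)‖ ≤ ε := by
  have hre : Continuous fun x : ℝ => (F x).re := by fun_prop
  have him : Continuous fun x : ℝ => (F x).im := by fun_prop
  obtain ⟨q₁, h₁⟩ := exists_polynomial_near_of_continuousOn (-C) C _ hre.continuousOn (ε / 2)
    (half_pos hε)
  obtain ⟨q₂, h₂⟩ := exists_polynomial_near_of_continuousOn (-C) C _ him.continuousOn (ε / 2)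
    (half_pos hε)
  refine ⟨q₁.map Complex.ofRealHom + Polynomial.C Complex.I * q₂.map Complex.ofRealHom,
    fun x hx => ?_⟩
  have e : ∀ q : Polynomial ℝ, (q.map Complex.ofRealHom).eval (x : ℂ) = ((q.eval x : ℝ) : ℂ) :=
    fun q => Polynomial.eval_map_apply (f := Complex.ofRealHom) (x := x)
  rw [Polynomial.eval_add, Polynomial.eval_mul, Polynomial.eval_C, e, e]
  have h3 := h₁ x (abs_le.1 hx)
  have h4 := h₂ x (abs_le.1 hx)
  rw [abs_sub_comm] at h3 h4
  refine (Complex.norm_le_abs_re_add_abs_im _).trans ?_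
  simp only [Complex.sub_re, Complex.sub_im, Complex.add_re, Complex.add_im, Complex.ofReal_re,
    Complex.ofReal_im, Complex.mul_re, Complex.mul_im, Complex.I_re, Complex.I_im]
  simp only [zero_mul, mul_zero, one_mul, add_zero, zero_add, sub_zero]
  linarith

namespace Matrix.IsHermitian

variable {N : Type*} [Fintype N] [DecidableEq N] {A : Matrix N N ℂ}

theorem eigSum_polynomial (hA : A.IsHermitian) (q : Polynomial ℂ) :
    eigSum (fun z => q.eval z) A =
      ∑ k ∈ Finset.range (q.natDegree + 1), q.coeff k * (A ^ k).trace := by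
  simp only [hA.eigSum_eq, Polynomial.eval_eq_sum_range, hA.trace_pow, Finset.mul_sum]
  exact Finset.sum_comm

theorem norm_eigSum_sub_le_of_near (hA : A.IsHermitian) {C : ℝ} (hC : A.RowSumLE C)
    {F G : ℂ → ℂ} {ε : ℝ} (h : ∀ x : ℝ, |x| ≤ C → ‖F x - G x‖ ≤ ε) :
    ‖eigSum F A - eigSum G A‖ ≤ Fintype.card N * ε := by
  rw [hA.eigSum_eq, hA.eigSum_eq, ← Finset.sum_sub_distrib, ← nsmul_eq_mul]
  exact (norm_sum_le _ _).trans (Finset.sum_le_card_nsmul _ _ _ fun i _ =>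
    h _ (hC.abs_eigenvalues_le hA i))

theorem norm_eigSum_le (hA : A.IsHermitian) {F : ℂ → ℂ} {K : ℝ} (hK : ∀ z, ‖F z‖ ≤ K) :
    ‖eigSum F A‖ ≤ Fintype.card N * K := by
  rw [hA.eigSum_eq, ← nsmul_eq_mul]
  exact (norm_sum_le _ _).trans (Finset.sum_le_card_nsmul _ _ _ fun i _ => hK _)

end Matrix.IsHermitian

/-- The Frobenius comparison gives this without any continuous choice of the individual eigenvalues.
-/
theorem continuous_eigSum {Y N : Type*} [TopologicalSpace Y] [Fintype N] [DecidableEq N]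
    {g : Y → Matrix N N ℂ} (hg : Continuous g) (hH : ∀ y, (g y).IsHermitian) {F : ℂ → ℂ}
    (hF : Continuous F) (hc : HasCompactSupport F) : Continuous fun y => eigSum F (g y) := by
  rw [continuous_iff_continuousAt]
  intro y₀
  rw [ContinuousAt, Metric.tendsto_nhds]
  intro ε hε
  obtain ⟨C, hC0, hC⟩ := exists_norm_sub_le_abs hF hc
    (show 0 < ε / 2 / (Fintype.card N + 1) by positivity)
  have h1 : Tendsto (fun y => C * (g y - g y₀).frobSq) (𝓝 y₀) (𝓝 0) := by
    have h2 : Continuous fun y => C * (g y - g y₀).frobSq := by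
      unfold Matrix.frobSq
      refine continuous_const.mul (continuous_finsetSum _ fun i _ => continuous_finsetSum _ fun j _ => ?_)
      exact (((hg.sub continuous_const).matrix_elem i j).norm).pow 2
    have h3 := h2.tendsto y₀
    simpa [Matrix.frobSq] using h3
  filter_upwards [h1.eventually_lt_const (half_pos hε)] with y hy
  rw [dist_eq_norm]
  refine lt_of_le_of_lt ((hH y).norm_eigSum_sub_le_frobSq (hH y₀) F hC) ?_
  have h4 : ε / 2 / (Fintype.card N + 1) * Fintype.card N ≤ ε / 2 := by
    rw [div_mul_eq_mul_div, div_le_iff₀ (by positivity)]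
    nlinarith
  linarith

/-! ### Eigenvalue distribution for continuous compactly supported weights -/

section Distribution

open TrigPoly

variable {d ν : ℕ}

/-- The range of the frequency variable. -/
def thetaBox (d : ℕ) : Set (Fin d → ℝ) := Set.Icc (fun _ => -Real.pi) (fun _ => Real.pi)

theorem volume_real_prod_thetaBox (Ω : Set (Fin d → ℝ)) :
    volume.real (Ω ×ˢ thetaBox d) = volume.real Ω * (2 * Real.pi) ^ d := by
  rw [Measure.volume_eq_prod, measureReal_def, Measure.prod_prod, ENNReal.toReal_mul, thetaBox,
    Real.volume_Icc_pi_toReal]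
  · simp [measureReal_def, two_mul]
  · intro _
    dsimp only
    linarith [Real.pi_pos]

theorem volume_prod_thetaBox_lt_top {Ω : Set (Fin d → ℝ)} (hΩ : volume Ω < ⊤) :
    volume (Ω ×ˢ thetaBox d) < ⊤ := by
  rw [Measure.volume_eq_prod, Measure.prod_prod]
  exact ENNReal.mul_lt_top hΩ measure_Icc_lt_top

/-- The mean of `F` over the eigenvalues of the symbol `p(x) b(θ)`. -/
noncomputable def symbolMean (Ω : Set (Fin d → ℝ)) (p : (Fin d → ℝ) → ℝ) (b : TrigPoly d ν)
    (F : ℂ → ℂ) : ℂ :=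
  (1 / (volume.real (Ω ×ˢ thetaBox d) : ℂ)) *
    ∫ y in Ω ×ˢ thetaBox d, (1 / (ν : ℂ)) * eigSum F ((p y.1 : ℂ) • evalTrig y.2 b)

theorem isHermitian_ofReal_smul {N : Type*} {A : Matrix N N ℂ} (hA : A.IsHermitian) (t : ℝ) :
    ((t : ℂ) • A).IsHermitian := by
  rw [Matrix.IsHermitian, Matrix.conjTranspose_smul, hA.eq, RCLike.star_def, Complex.conj_ofReal]

variable {Ω : Set (Fin d → ℝ)} {φ : (Fin d → ℝ) → ℝ} {b : TrigPoly d ν}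

theorem integrableOn_prod_thetaBox (hΩ : Ω ⊆ Set.Icc 0 1) {f : (Fin d → ℝ) × (Fin d → ℝ) → ℂ}
    (hf : Continuous f) : IntegrableOn f (Ω ×ˢ thetaBox d) :=
  (hf.continuousOn.integrableOn_compact
    (isCompact_Icc.prod isCompact_Icc)).mono_set (Set.prod_mono hΩ subset_rfl)

theorem continuous_symbol (hφ : Continuous φ) (b : TrigPoly d ν) :
    Continuous fun y : (Fin d → ℝ) × (Fin d → ℝ) => (φ y.1 : ℂ) • evalTrig y.2 b :=
  (Complex.continuous_ofReal.comp (hφ.comp continuous_fst)).smul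
    ((continuous_evalTrig b).comp continuous_snd)

/-- Evaluation commutes with powers, so the integrand is a product of functions of `x` and of `θ`;
the `θ`-integral extracts the constant term. -/
theorem integral_trace_pow_symbol (Ω : Set (Fin d → ℝ)) (φ : (Fin d → ℝ) → ℝ)
    (b : TrigPoly d ν) (k : ℕ) :
    ∫ y in Ω ×ˢ thetaBox d, (((φ y.1 : ℂ) • evalTrig y.2 b) ^ k).trace =
      ((∫ x in Ω, φ x ^ k : ℝ) : ℂ) * ((2 * Real.pi) ^ d * ((b ^ k).coeff 0).trace) := by
  simp only [smul_pow, ← map_pow, Matrix.trace_smul, smul_eq_mul]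
  rw [← integral_trace_evalTrig, ← integral_complex_ofReal, Measure.volume_eq_prod,
    setIntegral_prod_mul (fun x => (φ x : ℂ) ^ k) fun θ => (evalTrig θ (b ^ k)).trace]
  push_cast
  rfl

variable [NeZero d] [NeZero ν]

/-- The eigenvalue distribution of Hermitian locally Toeplitz matrices with continuous compactly
supported weight. -/
theorem tendsto_mean_eigSum_midSampled (hΩ : IsRegularDomain Ω) (hφ : Continuous φ)
    (hc : HasCompactSupport φ) (hs : tsupport φ ⊆ interior Ω)
    (hM : ∀ n, (midSampled Ω n φ b).IsHermitian) (hb : ∀ θ, (evalTrig θ b).IsHermitian)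
    {F : ℂ → ℂ} (hF : Continuous F) (hFc : HasCompactSupport F) :
    Tendsto (fun n : Fin d → ℕ => (1 / (Fintype.card (GridNode Ω n ν) : ℂ)) *
      eigSum F (midSampled Ω n φ b)) atTop (𝓝 (symbolMean Ω φ b F)) := by
  obtain ⟨C, hC⟩ := hc.exists_bound_of_continuous hφ
  have hν : (ν : ℂ) ≠ 0 := by exact_mod_cast NeZero.ne ν
  have hV : 0 < volume.real (Ω ×ˢ thetaBox d) := by
    rw [volume_real_prod_thetaBox]
    exact mul_pos hΩ.volume_real_pos (by positivity)
  have hg := continuous_symbol hφ b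
  have hgH : ∀ y : (Fin d → ℝ) × (Fin d → ℝ), ((φ y.1 : ℂ) • evalTrig y.2 b).IsHermitian :=
    fun y => isHermitian_ofReal_smul (hb _) _
  have hgC : ∀ y : (Fin d → ℝ) × (Fin d → ℝ),
      ((φ y.1 : ℂ) • evalTrig y.2 b).RowSumLE (C * coeffNorm b) := fun y =>
    (rowSumLE_evalTrig b y.2).of_norm_le ((abs_nonneg _).trans (hC 0)) fun r s => by
      rw [Matrix.smul_apply, norm_smul, Complex.norm_real]
      exact mul_le_mul_of_nonneg_right (hC _) (norm_nonneg _)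
  have hpoly : ∀ q : Polynomial ℂ, Tendsto (fun n : Fin d → ℕ =>
      (1 / (Fintype.card (GridNode Ω n ν) : ℂ)) *
        eigSum (fun z => q.eval z) (midSampled Ω n φ b)) atTop
      (𝓝 (symbolMean Ω φ b fun z => q.eval z)) := by
    intro q
    have h1 := tendsto_finsetSum (Finset.range (q.natDegree + 1)) fun k _ =>
      (tendsto_mean_trace_pow hΩ hφ hc hs b k).const_mul (q.coeff k)
    have h2 : symbolMean Ω φ b (fun z => q.eval z) =
        ∑ k ∈ Finset.range (q.natDegree + 1), q.coeff k * ((1 / ((volume.real Ω : ℂ) * ν)) *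
        (((∫ x in Ω, φ x ^ k : ℝ) : ℂ) * ((b ^ k).coeff 0).trace)) := by
      simp only [symbolMean, (hgH _).eigSum_polynomial]
      rw [integral_const_mul, integral_finsetSum, Finset.mul_sum, Finset.mul_sum]
      · refine Finset.sum_congr rfl fun k _ => ?_
        rw [integral_const_mul, integral_trace_pow_symbol, volume_real_prod_thetaBox]
        have hpi : (Real.pi : ℂ) ≠ 0 := by exact_mod_cast Real.pi_ne_zero
        have hvol : (volume.real Ω : ℂ) ≠ 0 := by exact_mod_cast hΩ.volume_real_pos.ne'
        push_cast
        field_simp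
      · intro k _
        exact (integrableOn_prod_thetaBox hΩ.subset_cube (hg.pow k).matrix_trace).const_mul _
    rw [h2]
    refine h1.congr fun n => ?_
    rw [(hM n).eigSum_polynomial, Finset.mul_sum]
    exact Finset.sum_congr rfl fun k _ => by ring
  rw [Metric.tendsto_nhds]
  intro ε hε
  -- The radius `C * coeffNorm b` bounds the spectra of all the matrices and of all the values of
  -- the symbol.
  obtain ⟨q, hq⟩ := exists_complex_polynomial_near hF (C * coeffNorm b) (show 0 < ε / 4 by positivity)
  have h1 : dist (symbolMean Ω φ b fun z => q.eval z) (symbolMean Ω φ b F) ≤ ε / 4 := by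
    have hqc : Continuous fun y : (Fin d → ℝ) × (Fin d → ℝ) =>
        eigSum (fun z => q.eval z) ((φ y.1 : ℂ) • evalTrig y.2 b) := by
      simp only [(hgH _).eigSum_polynomial]
      exact continuous_finsetSum _ fun k _ => continuous_const.mul (hg.pow k).matrix_trace
    rw [dist_comm, dist_eq_norm, symbolMean, symbolMean, ← mul_sub, ← integral_sub
      ((integrableOn_prod_thetaBox hΩ.subset_cube (continuous_eigSum hg hgH hF hFc)).const_mul _)
      ((integrableOn_prod_thetaBox hΩ.subset_cube hqc).const_mul _), norm_mul, norm_div, norm_one,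
      Complex.norm_real, Real.norm_of_nonneg hV.le, one_div_mul_eq_div, div_le_iff₀ hV]
    refine norm_setIntegral_le_of_norm_le_const (volume_prod_thetaBox_lt_top hΩ.volume_lt_top)
      fun y _ => ?_
    rw [← mul_sub, norm_mul, norm_div, norm_one, Complex.norm_natCast, one_div_mul_eq_div]
    refine div_le_of_le_mul₀ (Nat.cast_nonneg _) (by positivity) ?_
    have := (hgH y).norm_eigSum_sub_le_of_near (hgC y) (F := F) (G := fun z => q.eval z) hq
    rwa [Fintype.card_fin, mul_comm] at this
  filter_upwards [Metric.tendsto_nhds.1 (hpoly q) (ε / 4) (by positivity)] with n hn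
  have h2 : dist ((1 / (Fintype.card (GridNode Ω n ν) : ℂ)) * eigSum F (midSampled Ω n φ b))
      ((1 / (Fintype.card (GridNode Ω n ν) : ℂ)) *
        eigSum (fun z => q.eval z) (midSampled Ω n φ b)) ≤ ε / 4 := by
    rw [dist_eq_norm, ← mul_sub, norm_mul, norm_div, norm_one, Complex.norm_natCast,
      one_div_mul_eq_div]
    refine div_le_of_le_mul₀ (Nat.cast_nonneg _) (by positivity) ?_
    rw [mul_comm]
    exact (hM n).norm_eigSum_sub_le_of_near (rowSumLE_midSampled hC) hq
  calc _ ≤ _ + _ := dist_triangle _ _ _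
    _ ≤ ε / 4 + (ε / 4 + ε / 4) := add_le_add h2 ((dist_triangle _ _ _).trans (add_le_add hn.le h1))
    _ < ε := by linarith

end Distribution

/-! ### Approximation of an almost everywhere continuous weight -/

section Approximation

open TrigPoly

variable {d ν : ℕ} {Ω : Set (Fin d → ℝ)} {p : (Fin d → ℝ) → ℝ}

/-- The points of continuity in the interior of a regular domain have full measure. -/
theorem IsRegularDomain.ae_eq_continuityPoints (hΩ : IsRegularDomain Ω)
    (hp : ∀ᵐ x : Fin d → ℝ, x ∈ Ω → ContinuousWithinAt p Ω x) :
    (interior Ω ∩ {x | ContinuousAt p x} : Set (Fin d → ℝ)) =ᵐ[volume] Ω := by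
  have h2 : ∀ᵐ x : Fin d → ℝ, x ∉ frontier Ω := measure_eq_zero_iff_ae_notMem.1 hΩ.volume_frontier
  filter_upwards [hp, h2] with x hx hxf
  refine propext ⟨fun h => interior_subset h.1, fun h => ?_⟩
  have hi : x ∈ interior Ω := by
    by_contra h3
    exact hxf ⟨subset_closure h, h3⟩
  exact ⟨hi, (hx h).continuousAt (mem_interior_iff_mem_nhds.1 hi)⟩

theorem measurableSet_continuityPoints (Ω : Set (Fin d → ℝ)) (p : (Fin d → ℝ) → ℝ) :
    MeasurableSet (interior Ω ∩ {x | ContinuousAt p x}) :=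
  isOpen_interior.measurableSet.inter (IsGδ.setOfPred_continuousAt p).measurableSet

/-- Measurability of `p` is not assumed: it follows from continuity on a measurable set of full
measure in `Ω`. -/
theorem IsRegularDomain.aemeasurable (hΩ : IsRegularDomain Ω)
    (hp : ∀ᵐ x : Fin d → ℝ, x ∈ Ω → ContinuousWithinAt p Ω x) :
    AEMeasurable p (volume.restrict Ω) := by
  rw [← Measure.restrict_congr_set (hΩ.ae_eq_continuityPoints hp)]
  exact ContinuousOn.aemeasurable (fun x hx => ContinuousAt.continuousWithinAt hx.2)
    (measurableSet_continuityPoints Ω p)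

/-- An almost everywhere continuous function agrees with a continuous compactly supported function
on a compact set of almost full measure and is uniformly close to it around that set. -/
theorem IsRegularDomain.exists_continuous_approx (hΩ : IsRegularDomain Ω)
    (hp : ∀ᵐ x : Fin d → ℝ, x ∈ Ω → ContinuousWithinAt p Ω x) {ρ ε : ℝ} (hρ : 0 < ρ)
    (hε : 0 < ε) :
    ∃ (φ : (Fin d → ℝ) → ℝ) (K : Set (Fin d → ℝ)) (δ : ℝ), Continuous φ ∧ HasCompactSupport φ ∧
      tsupport φ ⊆ interior Ω ∧ IsCompact K ∧ volume.real (Ω \ K) < ρ ∧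
      (∀ x ∈ K, φ x = p x) ∧ 0 < δ ∧ ∀ y ∈ Metric.thickening δ K, |p y - φ y| < ε := by
  have hS := hΩ.ae_eq_continuityPoints hp
  have hSfin : volume (interior Ω ∩ {x | ContinuousAt p x}) ≠ ⊤ := by
    rw [measure_congr hS]
    exact hΩ.volume_lt_top.ne
  obtain ⟨K, hKS, hK, hKρ⟩ := (measurableSet_continuityPoints Ω p).exists_isCompact_sdiff_lt hSfin
    (ε := ENNReal.ofReal ρ) (by simpa using hρ)
  have hdiff : volume.real (Ω \ K) < ρ := by
    have h1 : (Ω \ K : Set (Fin d → ℝ)) =ᵐ[volume]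
        ((interior Ω ∩ {x | ContinuousAt p x}) \ K : Set (Fin d → ℝ)) :=
      hS.symm.diff (ae_eq_refl K)
    rw [measureReal_def, measure_congr h1]
    exact (ENNReal.lt_ofReal_iff_toReal_lt hKρ.ne_top).1 hKρ
  have hpK : ContinuousOn p K := fun x hx => ContinuousAt.continuousWithinAt (hKS hx).2
  -- Tietze extends `p` from `K`, and a Urysohn cutoff `χ` confines the support to `interior Ω`.
  obtain ⟨g, hg⟩ := ContinuousMap.exists_restrict_eq hK.isClosed ⟨K.domRestrict p, hpK.domRestrict⟩
  obtain ⟨χ, hχ1, hχc, hχs, -⟩ := exists_continuousMap_one_of_isCompact_subset_isOpen hK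
    (isOpen_interior (s := Ω)) fun x hx => (hKS hx).1
  have hφK : ∀ x ∈ K, χ x * g x = p x := by
    intro x hx
    have h1 : g x = p x := congrArg (fun f : C(K, ℝ) => f ⟨x, hx⟩) hg
    rw [hχ1 hx, Pi.one_apply, one_mul, h1]
  have hφ : Continuous fun x => χ x * g x := by fun_prop
  -- Points of `K` are continuity points of `p` in the whole space, so the difference, zero on `K`,
  -- is small on full neighbourhoods; compactness then gives a uniform `δ`.
  have hKV : K ⊆ interior {y | |p y - χ y * g y| < ε} := by
    intro x hx
    rw [mem_interior_iff_mem_nhds]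
    have h1 : ContinuousAt (fun y => |p y - χ y * g y|) x :=
      (ContinuousAt.sub (hKS hx).2 hφ.continuousAt).abs
    refine h1.eventually_lt_const ?_
    change |p x - χ x * g x| < ε
    rw [hφK x hx, sub_self, abs_zero]
    exact hε
  obtain ⟨δ, hδ, hδV⟩ := hK.exists_thickening_subset_open isOpen_interior hKV
  refine ⟨fun x => χ x * g x, K, δ, hφ, HasCompactSupport.mul_right hχc,
    (closure_mono (Function.support_mul_subset_left _ _)).trans hχs, hK,
    hdiff, hφK, hδ, fun y hy => ?_⟩
  exact interior_subset (s := {y | |p y - χ y * g y| < ε}) (hδV hy)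

theorem aemeasurable_prodMk_snd {f : (Fin d → ℝ) → ℝ} (hf : AEMeasurable f (volume.restrict Ω)) :
    AEMeasurable (fun y : (Fin d → ℝ) × (Fin d → ℝ) => (f y.1, y.2))
      (volume.restrict (Ω ×ˢ thetaBox d)) := by
  rw [Measure.volume_eq_prod, ← Measure.prod_restrict]
  exact (hf.comp_quasiMeasurePreserving Measure.quasiMeasurePreserving_fst).prodMk
    measurable_snd.aemeasurable

theorem IsRegularDomain.nullMeasurableSet_prod_thetaBox (hΩ : IsRegularDomain Ω) :
    NullMeasurableSet (Ω ×ˢ thetaBox d) volume := by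
  rw [Measure.volume_eq_prod]
  exact hΩ.nullMeasurable.prod measurableSet_Icc.nullMeasurableSet

/-- Changing the weight off a set of small measure changes the mean of the symbol little. -/
theorem norm_symbolMean_sub_le [NeZero ν] (hΩ : IsRegularDomain Ω)
    (hp : ∀ᵐ x : Fin d → ℝ, x ∈ Ω → ContinuousWithinAt p Ω x) {b : TrigPoly d ν}
    (hb : ∀ θ, (evalTrig θ b).IsHermitian) {φ : (Fin d → ℝ) → ℝ} (hφ : Continuous φ)
    {K : Set (Fin d → ℝ)} (hφK : ∀ x ∈ K, φ x = p x) {F : ℂ → ℂ} (hF : Continuous F)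
    (hFc : HasCompactSupport F) {k : ℝ} (hk : ∀ z, ‖F z‖ ≤ k) :
    ‖symbolMean Ω φ b F - symbolMean Ω p b F‖ ≤ 2 * k * (volume.real (Ω \ K) / volume.real Ω) := by
  have hk0 : 0 ≤ k := (norm_nonneg _).trans (hk 0)
  have hG : Continuous fun z : ℝ × (Fin d → ℝ) =>
      (1 / (ν : ℂ)) * eigSum F ((z.1 : ℂ) • evalTrig z.2 b) := by
    refine continuous_const.mul (continuous_eigSum ?_ (fun z => isHermitian_ofReal_smul (hb _) _)
      hF hFc)
    exact (Complex.continuous_ofReal.comp continuous_fst).smul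
      ((continuous_evalTrig b).comp continuous_snd)
  have hbound : ∀ (t : ℝ) θ, ‖(1 / (ν : ℂ)) * eigSum F ((t : ℂ) • evalTrig θ b)‖ ≤ k := by
    intro t θ
    rw [norm_mul, norm_div, norm_one, Complex.norm_natCast, one_div_mul_eq_div]
    refine div_le_of_le_mul₀ (Nat.cast_nonneg _) hk0 ?_
    have := (isHermitian_ofReal_smul (hb θ) t).norm_eigSum_le hk
    rwa [Fintype.card_fin, mul_comm] at this
  have hDfin := volume_prod_thetaBox_lt_top hΩ.volume_lt_top
  have : IsFiniteMeasure (volume.restrict (Ω ×ˢ thetaBox d)) := ⟨by rwa [Measure.restrict_apply_univ]⟩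
  have hint : ∀ f : (Fin d → ℝ) → ℝ, AEMeasurable f (volume.restrict Ω) → IntegrableOn
      (fun y : (Fin d → ℝ) × (Fin d → ℝ) => (1 / (ν : ℂ)) * eigSum F ((f y.1 : ℂ) • evalTrig y.2 b))
      (Ω ×ˢ thetaBox d) := by
    intro f hf
    exact Integrable.of_bound
      (hG.measurable.comp_aemeasurable (aemeasurable_prodMk_snd hf)).aestronglyMeasurable k
      (Eventually.of_forall fun y => hbound _ _)
  have hD := hΩ.nullMeasurableSet_prod_thetaBox
  have hV : 0 < volume.real (Ω ×ˢ thetaBox d) := by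
    rw [volume_real_prod_thetaBox]
    exact mul_pos hΩ.volume_real_pos (by positivity)
  -- The integrands agree over `K`, so only `Ω \ K` contributes, with integrand at most `2 * k`.
  rw [symbolMean, symbolMean, ← mul_sub, ← integral_sub (hint φ hφ.aemeasurable)
    (hint p (hΩ.aemeasurable hp)), setIntegral_eq_of_subset_of_ae_sdiff_eq_zero hD
    (Set.prod_mono (Set.sdiff_subset (s := Ω) (t := K)) (subset_refl (thetaBox d)))]
  · have h1 : volume (((Ω \ K) ×ˢ thetaBox d)) < ⊤ :=
      volume_prod_thetaBox_lt_top ((measure_mono Set.sdiff_subset).trans_lt hΩ.volume_lt_top)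
    have h2 := norm_setIntegral_le_of_norm_le_const (C := 2 * k) h1
      (f := fun y : (Fin d → ℝ) × (Fin d → ℝ) =>
        (1 / (ν : ℂ)) * eigSum F ((φ y.1 : ℂ) • evalTrig y.2 b) -
        (1 / (ν : ℂ)) * eigSum F ((p y.1 : ℂ) • evalTrig y.2 b)) fun y _ =>
      (norm_sub_le _ _).trans (by linarith [hbound (φ y.1) y.2, hbound (p y.1) y.2])
    rw [norm_mul, norm_div, norm_one, Complex.norm_real, Real.norm_of_nonneg hV.le,
      one_div_mul_eq_div, div_le_iff₀ hV]
    refine h2.trans (le_of_eq ?_)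
    rw [volume_real_prod_thetaBox, volume_real_prod_thetaBox]
    have := hΩ.volume_real_pos.ne'
    field_simp
  · refine Eventually.of_forall fun y hy => ?_
    have hyK : y.1 ∈ K := by
      by_contra h
      exact hy.2 ⟨⟨hy.1.1, h⟩, hy.1.2⟩
    rw [hφK _ hyK, sub_self]

variable [NeZero d] [NeZero ν]

/-- Few nodes lie away from a compact set of almost full measure. -/
theorem eventually_exists_card_le (hΩ : IsRegularDomain Ω) {K : Set (Fin d → ℝ)} (hK : IsCompact K)
    {δ ρ : ℝ} (hδ : 0 < δ) (hρ : volume.real (Ω \ K) < ρ * volume.real Ω) :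
    ∀ᶠ n : Fin d → ℕ in atTop, ∃ Bad : Finset (GridNode Ω n ν),
      (∀ u, u ∉ Bad → immersion n u.1 ∈ Metric.thickening δ K) ∧
      (Bad.card : ℝ) ≤ ρ * Fintype.card (GridNode Ω n ν) := by
  classical
  -- The function `1 - ψ` dominates the indicator of the bad nodes and vanishes on `K`. Being
  -- continuous, it has a limiting mean over the nodes, at most `volume (Ω \ K) / volume Ω`.
  obtain ⟨ψ, hψ1, hψc, hψs, hψ01⟩ := exists_continuousMap_one_of_isCompact_subset_isOpen hK
    (Metric.isOpen_thickening (δ := δ) (E := K)) (Metric.self_subset_thickening hδ K)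
  have hνr : (0 : ℝ) < ν := by exact_mod_cast NeZero.pos ν
  have hlim : Tendsto (fun n : Fin d → ℕ => (1 / (Fintype.card (GridNode Ω n ν) : ℝ)) *
      ∑ u : GridNode Ω n ν, (1 - ψ (immersion n u.1))) atTop
      (𝓝 ((1 / (volume.real Ω * ν)) * ((∫ x in Ω, (1 - ψ x)) * ν))) := by
    have h1 := tendsto_mean_gridNode (ν := ν) hΩ (ψ := fun x => 1 - ψ x) (by fun_prop) (K := 1)
      (fun x => abs_le.2 ⟨by linarith [(hψ01 x).2], by linarith [(hψ01 x).1]⟩) (fun _ => 1)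
    have h2 := (Complex.continuous_re.tendsto _).comp h1
    have e : ((1 / ((volume.real Ω : ℂ) * ν)) * (((∫ x in Ω, (1 - ψ x) : ℝ) : ℂ) *
        ∑ _r : Fin ν, (1 : ℂ))) =
        (((1 / (volume.real Ω * ν)) * ((∫ x in Ω, (1 - ψ x)) * ν) : ℝ) : ℂ) := by
      simp
    rw [e, Complex.ofReal_re] at h2
    refine h2.congr fun n => ?_
    simp only [Function.comp_apply, mul_one]
    rw [← Complex.ofReal_sum, ← Complex.ofReal_natCast, ← Complex.ofReal_one, ← Complex.ofReal_div,
      ← Complex.ofReal_mul, Complex.ofReal_re]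
  have hint : ∫ x in Ω, (1 - ψ x) ≤ volume.real (Ω \ K) := by
    rw [setIntegral_eq_of_subset_of_ae_sdiff_eq_zero hΩ.nullMeasurable
      (Set.sdiff_subset (s := Ω) (t := K))]
    · have h1 : volume (Ω \ K) < ⊤ := (measure_mono Set.sdiff_subset).trans_lt hΩ.volume_lt_top
      have h2 := norm_setIntegral_le_of_norm_le_const (C := 1) h1 (f := fun x => 1 - ψ x)
        fun x _ => abs_le.2 ⟨by linarith [(hψ01 x).2], by linarith [(hψ01 x).1]⟩
      rw [one_mul] at h2
      exact (Real.le_norm_self _).trans h2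
    · refine Eventually.of_forall fun x hx => ?_
      have hxK : x ∈ K := by
        by_contra h
        exact hx.2 ⟨hx.1, h⟩
      rw [hψ1 hxK, Pi.one_apply, sub_self]
  have hlt : (1 / (volume.real Ω * ν)) * ((∫ x in Ω, (1 - ψ x)) * ν) < ρ := by
    rw [one_div_mul_eq_div, mul_div_mul_right _ _ hνr.ne', div_lt_iff₀ hΩ.volume_real_pos]
    exact hint.trans_lt hρ
  filter_upwards [hlim.eventually_lt_const hlt,
    (tendsto_card_gridNode_atTop (ν := ν) hΩ).eventually_gt_atTop 0] with n hn hcard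
  have hcard' : (0 : ℝ) < Fintype.card (GridNode Ω n ν) := by exact_mod_cast hcard
  refine ⟨Finset.univ.filter fun u => immersion n u.1 ∉ Metric.thickening δ K, fun u hu => ?_, ?_⟩
  · by_contra h
    exact hu (Finset.mem_filter.2 ⟨Finset.mem_univ _, h⟩)
  · rw [one_div_mul_eq_div, div_lt_iff₀ hcard'] at hn
    refine le_trans ?_ hn.le
    rw [Finset.card_filter]
    push_cast
    refine Finset.sum_le_sum fun u _ => ?_
    split_ifs with h
    · linarith [(hψ01 (immersion n u.1)).2]
    · rw [image_eq_zero_of_notMem_tsupport fun h' => h (hψs h'), sub_zero]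

end Approximation

/-! ### Stability under changes of weight and diagonal -/

section Perturbation

open TrigPoly

variable {d ν : ℕ} [NeZero d] {Ω : Set (Fin d → ℝ)} {n : Fin d → ℕ} {b : TrigPoly d ν}

/-- The midpoint is symmetric in the two nodes; sampling at the row node would lose this. -/
theorem isHermitian_midSampled (hb : ∀ δ r s, b.coeff (-δ) s r = star (b.coeff δ r s))
    (Ω : Set (Fin d → ℝ)) (n : Fin d → ℕ) (p : (Fin d → ℝ) → ℝ) :
    (midSampled Ω n p b).IsHermitian := by
  ext u v
  have h : indexDiff v.1.1 u.1.1 = -indexDiff u.1.1 v.1.1 := by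
    funext q
    simp [indexDiff]
  simp only [Matrix.conjTranspose_apply, midSampled, Matrix.of_apply, star_mul']
  rw [h, hb, star_star, RCLike.star_def, Complex.conj_ofReal, add_comm]

/-- Eigenvalue sums of a locally Toeplitz matrix are stable under a small diagonal perturbation and
a change of the weight that is small except between few nodes. -/
theorem norm_eigSum_midSampled_sub_le (hb : ∀ δ r s, b.coeff (-δ) s r = star (b.coeff δ r s))
    {p φ : (Fin d → ℝ) → ℝ} {τ : GridNode Ω n ν → ℝ} {ε : ℝ} (hε : 0 ≤ ε) (hτ : ∀ u, |τ u| ≤ ε)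
    (Bad : Finset (GridNode Ω n ν))
    (hgood : ∀ u v : GridNode Ω n ν, u ∉ Bad ∨ v ∉ Bad →
      indexDiff u.1.1 v.1.1 ∈ b.coeff.support →
      |p ((1 / 2 : ℝ) • (immersion n u.1 + immersion n v.1)) -
        φ ((1 / 2 : ℝ) • (immersion n u.1 + immersion n v.1))| ≤ ε)
    {F : ℂ → ℂ} {η C C' : ℝ} (hC : 0 ≤ C) (hC' : 0 ≤ C')
    (hF : ∀ x y : ℝ, ‖F x - F y‖ ≤ η + C * ‖resolventFun x - resolventFun y‖ ^ 2)
    (hF' : ∀ x y : ℝ, ‖F x - F y‖ ≤ η + C' * |x - y| ^ 2) :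
    ‖eigSum F (Matrix.diagonal (fun u => (τ u : ℂ)) + midSampled Ω n p b) -
        eigSum F (midSampled Ω n φ b)‖ ≤
      (η * Fintype.card (GridNode Ω n ν) + C * (4 * Bad.card)) +
      (η * Fintype.card (GridNode Ω n ν) +
        C' * (Fintype.card (GridNode Ω n ν) * (ε + ε * coeffNorm b) ^ 2)) := by
  set Z := midSampled Ω n (fun x => p x - φ x) b with hZ
  have hZH : Z.IsHermitian := isHermitian_midSampled hb Ω n _
  have hZeq : midSampled Ω n p b = midSampled Ω n φ b + Z := by
    ext u v
    simp only [hZ, midSampled, Matrix.of_apply, Matrix.add_apply]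
    push_cast
    ring
  -- `Z₁` keeps the pairs with at least one good node, where the weights differ by at most `ε`; `Z₂`
  -- keeps the bad block, which is unbounded but of small rank.
  set Z₁ : Matrix (GridNode Ω n ν) (GridNode Ω n ν) ℂ :=
    Matrix.of fun u v => if u ∈ Bad ∧ v ∈ Bad then 0 else Z u v with hZ₁
  set Z₂ : Matrix (GridNode Ω n ν) (GridNode Ω n ν) ℂ :=
    Matrix.of fun u v => if u ∈ Bad ∧ v ∈ Bad then Z u v else 0 with hZ₂
  have hZ12 : Z = Z₁ + Z₂ := by
    ext u v
    simp only [hZ₁, hZ₂, Matrix.add_apply, Matrix.of_apply]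
    split_ifs <;> simp
  have hZ₁H : Z₁.IsHermitian := by
    ext u v
    simp only [hZ₁, Matrix.conjTranspose_apply, Matrix.of_apply, and_comm (a := v ∈ Bad)]
    split_ifs
    · exact star_zero _
    · exact hZH.apply u v
  set Dτ : Matrix (GridNode Ω n ν) (GridNode Ω n ν) ℂ :=
    Matrix.diagonal fun u => (τ u : ℂ) with hDτ
  have hDH : Dτ.IsHermitian := by
    rw [hDτ, Matrix.IsHermitian, Matrix.diagonal_conjTranspose]
    congr 1
    funext u
    exact Complex.conj_ofReal _
  have hM : (midSampled Ω n φ b).IsHermitian := isHermitian_midSampled hb Ω n φ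
  have hA : (midSampled Ω n φ b + (Dτ + Z₁)).IsHermitian := hM.add (hDH.add hZ₁H)
  have hX : (Dτ + midSampled Ω n p b).IsHermitian := hDH.add (isHermitian_midSampled hb Ω n p)
  have hrow : (Dτ + Z₁).RowSumLE (ε + ε * coeffNorm b) := by
    refine Matrix.RowSumLE.add (fun u => ?_) (rowSumLE_of_norm_le hε fun u v => ?_)
    · rw [Finset.sum_eq_single u]
      · rw [hDτ, Matrix.diagonal_apply_eq, Complex.norm_real]
        exact hτ u
      · intro v _ hv
        rw [hDτ, Matrix.diagonal_apply_ne _ hv.symm, norm_zero]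
      · simp
    · rw [hZ₁, Matrix.of_apply]
      split_ifs with h
      · rw [norm_zero]
        positivity
      · rw [hZ, midSampled, Matrix.of_apply, norm_mul]
        by_cases hv : indexDiff u.1.1 v.1.1 ∈ b.coeff.support
        · refine mul_le_mul_of_nonneg_right ?_ (norm_nonneg _)
          rw [Complex.norm_real]
          exact hgood u v (not_and_or.1 h) hv
        · rw [coeff_eq_zero hv, norm_zero, mul_zero, mul_zero]
  have hrank : (Dτ + midSampled Ω n p b - (midSampled Ω n φ b + (Dτ + Z₁))).rank ≤ Bad.card := by
    -- The difference is `Z₂`, unchanged by the projection onto the bad rows, whose rank is at most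
    -- `Bad.card`.
    have h1 : Dτ + midSampled Ω n p b - (midSampled Ω n φ b + (Dτ + Z₁)) =
        Matrix.diagonal (fun u => if u ∈ Bad then (1 : ℂ) else 0) * Z₂ := by
      rw [hZeq, hZ12]
      ext u v
      rw [Matrix.diagonal_mul]
      simp only [Matrix.add_apply, Matrix.sub_apply, hZ₂, Matrix.of_apply]
      by_cases hu : u ∈ Bad <;> simp only [hu, true_and, false_and, if_true, if_false] <;> ring
    rw [h1]
    refine (Matrix.rank_mul_le_left _ _).trans ?_
    rw [Matrix.rank_diagonal, Fintype.card_subtype]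
    refine Finset.card_le_card fun u hu => ?_
    by_contra h
    simp [h] at hu
  have h1 := hA.norm_eigSum_sub_le_rank hX F hC hF
  have h2 := hA.norm_eigSum_sub_le_frobSq hM F hF'
  rw [add_sub_cancel_left] at h2
  rw [norm_sub_rev] at h1
  have h3 : C * (4 * ((Dτ + midSampled Ω n p b - (midSampled Ω n φ b + (Dτ + Z₁))).rank : ℝ)) ≤
      C * (4 * Bad.card) := by
    gcongr
  have h4 := mul_le_mul_of_nonneg_left hrow.frobSq_le hC'
  refine (norm_sub_le_norm_sub_add_norm_sub _
    (eigSum F (midSampled Ω n φ b + (Dτ + Z₁))) _).trans (add_le_add ?_ ?_)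
  · linarith
  · linarith

end Perturbation

/-! ### The graph-Laplacians -/

section GridLaplacian

open TrigPoly

namespace DiamondData

variable {d m ν : ℕ}

theorem coeff_shiftedPoly_neg (T : DiamondData d m ν) (c : ℝ) (δ : Fin d → ℤ) (r s : Fin ν) :
    (T.shiftedPoly c).coeff (-δ) s r = star ((T.shiftedPoly c).coeff δ r s) := by
  rw [coeff_shiftedPoly, coeff_shiftedPoly, block_neg]
  simp only [Matrix.sub_apply, Matrix.map_apply, Matrix.transpose_apply, neg_eq_zero, star_sub,
    RCLike.star_def, Complex.conj_ofReal]
  congr 1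
  by_cases h : δ = 0
  · simp only [if_pos h]
    by_cases hrs : r = s
    · subst hrs
      simp
    · simp [Matrix.one_apply_ne hrs, Matrix.one_apply_ne (Ne.symm hrs)]
  · simp [h]

variable [NeZero d]

/-- The graph-Laplacian of the grid graph as a locally Toeplitz matrix. -/
theorem laplacian_eq_midSampled (T : DiamondData d m ν) (Ω : Set (Fin d → ℝ))
    (p : (Fin d → ℝ) → ℝ) (n : Fin d → ℕ) (κ : GridNode Ω n ν → ℝ) (c : ℝ) :
    ((T.gridGraph Ω p n).laplacian κ).map Complex.ofReal =
      Matrix.diagonal (fun u => (((T.gridGraph Ω p n).deg u + κ u - c * p (immersion n u.1) : ℝ) : ℂ)) +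
        midSampled Ω n p (T.shiftedPoly c) := by
  ext u v
  rw [Matrix.map_apply, WeightedGraph.laplacian, WeightedGraph.degMatrix, WeightedGraph.adjMatrix,
    Matrix.add_apply, Matrix.sub_apply, Matrix.add_apply, Matrix.of_apply, midSampled,
    Matrix.of_apply, coeff_shiftedPoly, Matrix.sub_apply, Matrix.map_apply]
  have hw : (T.gridGraph Ω p n).w u v = p ((1 / 2 : ℝ) • (immersion n u.1 + immersion n v.1)) *
      T.block (indexDiff u.1.1 v.1.1) u.1.2 v.1.2 := rfl
  rw [hw]
  by_cases h : u = v
  · subst h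
    have h4 : (1 / 2 : ℝ) • (immersion n u.1 + immersion n u.1) = immersion n u.1 := by
      rw [← two_smul ℝ, smul_smul]
      norm_num
    rw [Matrix.diagonal_apply_eq, Matrix.diagonal_apply_eq, Matrix.diagonal_apply_eq, indexDiff_self,
      if_pos rfl, Matrix.smul_apply, Matrix.one_apply_eq, h4, smul_eq_mul]
    push_cast
    ring
  · have h5 : (if indexDiff u.1.1 v.1.1 = 0 then (c : ℂ) • (1 : Matrix (Fin ν) (Fin ν) ℂ) else 0)
        u.1.2 v.1.2 = 0 := by
      split_ifs with h1
      · have h2 : u.1.2 ≠ v.1.2 := fun h2 =>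
          h (Subtype.ext (Prod.ext ((indexDiff_eq_zero_iff _ _).1 h1) h2))
        rw [Matrix.smul_apply, Matrix.one_apply_ne h2, smul_zero]
      · rfl
    rw [Matrix.diagonal_apply_ne _ h, Matrix.diagonal_apply_ne _ h, Matrix.diagonal_apply_ne _ h, h5]
    push_cast
    ring

end DiamondData

/-- The eigenvalue distribution of the graph-Laplacians. -/
theorem tendsto_mean_eigSum_laplacian {d m ν : ℕ} [NeZero d] [NeZero ν] (T : DiamondData d m ν)
    (Ω : Set (Fin d → ℝ)) (hΩ : IsRegularDomain Ω)
    (p : (Fin d → ℝ) → ℝ) (hp : ∀ᵐ x : Fin d → ℝ, x ∈ Ω → ContinuousWithinAt p Ω x)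
    {ι : Type*} (l : Filter ι) (n : ι → Fin d → ℕ) (hn : Tendsto n l atTop)
    (κ : ∀ a, GridNode Ω (n a) ν → ℝ) (c : ℝ)
    (hτ : ∀ ε : ℝ, 0 < ε → ∀ᶠ a in l, ∀ u : GridNode Ω (n a) ν,
      |(T.gridGraph Ω p (n a)).deg u + κ a u - c * p (immersion (n a) u.1)| ≤ ε)
    {F : ℂ → ℂ} (hF : Continuous F) (hFc : HasCompactSupport F) :
    Tendsto (fun a => (1 / (Fintype.card (GridNode Ω (n a) ν) : ℂ)) *
      eigSum F (((T.gridGraph Ω p (n a)).laplacian (κ a)).map Complex.ofReal)) l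
      (𝓝 (symbolMean Ω p (T.shiftedPoly c) F)) := by
  set b := T.shiftedPoly c with hbdef
  have hbc := T.coeff_shiftedPoly_neg c
  have hbH : ∀ θ, (evalTrig θ b).IsHermitian := fun θ => by
    rw [hbdef, T.evalTrig_shiftedPoly]
    exact T.isHermitian_shifted_symbol c θ
  have hcn := coeffNorm_nonneg b
  rw [Metric.tendsto_nhds]
  intro e he
  obtain ⟨k, hk⟩ := hFc.exists_bound_of_continuous hF
  have hk0 : 0 ≤ k := (norm_nonneg _).trans (hk 0)
  have he6 : 0 < e / 6 := by positivity
  obtain ⟨C, hC, hFC⟩ := exists_norm_sub_le_resolventFun hF hFc he6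
  obtain ⟨C', hC', hFC'⟩ := exists_norm_sub_le_abs hF hFc he6
  -- One share `e / 6` pays for both effects of the exceptional set: `4 * C * ρ` from the rank and
  -- `2 * k * ρ` from the symbol.
  set ρ : ℝ := e / 6 / (4 * C + 2 * k + 1) with hρ
  have hρ0 : 0 < ρ := by positivity
  have hρe : 4 * C * ρ + 2 * k * ρ ≤ e / 6 := by
    have : (4 * C + 2 * k + 1) * ρ = e / 6 := by
      rw [hρ]
      field_simp
    nlinarith
  -- The cap at 1 gives `ε ^ 2 ≤ ε`, which makes the quadratic Frobenius error at most `e / 6`.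
  set ε : ℝ := min 1 (e / 6 / ((C' + 1) * (1 + coeffNorm b) ^ 2)) with hε
  have hε0 : 0 < ε := by positivity
  have hεe : C' * (ε + ε * coeffNorm b) ^ 2 ≤ e / 6 := by
    have h1 : ε ^ 2 ≤ ε := by
      rw [sq]
      exact mul_le_of_le_one_left hε0.le (min_le_left _ _)
    have h2 : ε * ((C' + 1) * (1 + coeffNorm b) ^ 2) ≤ e / 6 := by
      rw [← le_div_iff₀ (by positivity)]
      exact min_le_right _ _
    have h3 : ε ^ 2 * ((C' + 1) * (1 + coeffNorm b) ^ 2) ≤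
        ε * ((C' + 1) * (1 + coeffNorm b) ^ 2) :=
      mul_le_mul_of_nonneg_right h1 (by positivity)
    have h4 : 0 ≤ ε ^ 2 * (1 + coeffNorm b) ^ 2 := by positivity
    nlinarith
  have hvol := hΩ.volume_real_pos
  obtain ⟨φ, K, δ, hφ, hφc, hφs, hK, hKρ, hφK, hδ, hpφ⟩ :=
    hΩ.exists_continuous_approx hp (mul_pos hρ0 hvol) hε0
  have hsym : ‖symbolMean Ω φ b F - symbolMean Ω p b F‖ ≤ 2 * k * ρ := by
    refine (norm_symbolMean_sub_le hΩ hp hbH hφ hφK hF hFc hk).trans ?_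
    have : volume.real (Ω \ K) / volume.real Ω ≤ ρ := (div_le_iff₀ hvol).2 hKρ.le
    gcongr
  have hlim := (tendsto_mean_eigSum_midSampled hΩ hφ hφc hφs
    (fun n => isHermitian_midSampled hbc Ω n φ) hbH hF hFc).comp hn
  filter_upwards [Metric.tendsto_nhds.1 hlim (e / 6) he6, hτ ε hε0,
    hn.eventually (eventually_exists_card_le (ν := ν) hΩ hK (half_pos hδ) hKρ),
    hn.eventually (eventually_dist_immersion_lt (ν := ν) b.coeff.support hδ),
    hn.eventually ((tendsto_card_gridNode_atTop (ν := ν) hΩ).eventually_gt_atTop 0)]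
    with a h1 h2 h3 h4 h5
  obtain ⟨Bad, hBad, hBadcard⟩ := h3
  -- One node near `K` is enough: the midpoint is less than `δ / 2` from it, hence within `δ` of
  -- `K`.
  have hmid : ∀ x y : Fin d → ℝ, x ∈ Metric.thickening (δ / 2) K → dist x y < δ →
      (1 / 2 : ℝ) • (x + y) ∈ Metric.thickening δ K := by
    intro x y hx hxy
    obtain ⟨z, hz, hxz⟩ := Metric.mem_thickening_iff.1 hx
    refine Metric.mem_thickening_iff.2 ⟨z, hz, ?_⟩
    have h6 : dist ((1 / 2 : ℝ) • (x + y)) x = dist x y / 2 := by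
      rw [dist_eq_norm, dist_eq_norm]
      have : (1 / 2 : ℝ) • (x + y) - x = (1 / 2 : ℝ) • (y - x) := by module
      rw [this, norm_smul, norm_sub_rev]
      norm_num
      ring
    have := dist_triangle ((1 / 2 : ℝ) • (x + y)) x z
    linarith
  have hpert := norm_eigSum_midSampled_sub_le (Ω := Ω) (n := n a) hbc hε0.le h2 Bad
    (p := p) (φ := φ) (fun u v huv hS => by
      refine (hpφ _ ?_).le
      have hd := h4 u.1 v.1 hS
      rcases huv with hu | hv
      · exact hmid _ _ (hBad u hu) hd
      · rw [add_comm]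
        exact hmid _ _ (hBad v hv) (by rwa [dist_comm])) hC hC' hFC hFC'
  rw [← T.laplacian_eq_midSampled Ω p (n a) (κ a) c] at hpert
  set N : ℝ := (Fintype.card (GridNode Ω (n a) ν) : ℝ) with hN
  have hN0 : 0 < N := by rw [hN]; exact_mod_cast h5
  have hmean : dist ((1 / (Fintype.card (GridNode Ω (n a) ν) : ℂ)) *
      eigSum F (((T.gridGraph Ω p (n a)).laplacian (κ a)).map Complex.ofReal))
      ((1 / (Fintype.card (GridNode Ω (n a) ν) : ℂ)) * eigSum F (midSampled Ω (n a) φ b)) ≤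
      e / 6 + 4 * C * ρ + (e / 6 + e / 6) := by
    rw [dist_eq_norm, ← mul_sub, norm_mul, norm_div, norm_one, Complex.norm_natCast,
      one_div_mul_eq_div, ← hN, div_le_iff₀ hN0]
    refine hpert.trans ?_
    have h6 := mul_le_mul_of_nonneg_left hBadcard hC
    have h7 := mul_le_mul_of_nonneg_right hεe hN0.le
    linarith
  have hsym' : dist (symbolMean Ω φ b F) (symbolMean Ω p b F) ≤ 2 * k * ρ := by
    rwa [dist_eq_norm]
  -- Four errors of `e / 6` and the share governed by `ρ` add up to at most `5 e / 6`.
  calc _ ≤ _ + _ := dist_triangle _ _ _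
    _ ≤ (e / 6 + 4 * C * ρ + (e / 6 + e / 6)) + (e / 6 + 2 * k * ρ) :=
        add_le_add hmean ((dist_triangle _ _ _).trans (add_le_add h1.le hsym'))
    _ < e := by linarith

end GridLaplacian

/-- `n → ∞` means that all components tend to infinity, along all `d`-indices (`n = id`,
`l = atTop`) or along any family of them. Both `D + K` and `c I diag(p)` are diagonal, so `o(1)` in
spectral norm is the uniform smallness of the entries of their difference. -/
theorem corollary4p2 {d m ν : ℕ} [NeZero d] [NeZero ν] (T : DiamondData d m ν)
    (Ω : Set (Fin d → ℝ)) (hΩ : IsRegularDomain Ω)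
    (p : (Fin d → ℝ) → ℝ) (hp : ∀ᵐ x : Fin d → ℝ, x ∈ Ω → ContinuousWithinAt p Ω x)
    {ι : Type*} (l : Filter ι) (n : ι → Fin d → ℕ) (hn : Tendsto n l atTop)
    (κ : ∀ a, GridNode Ω (n a) ν → ℝ) (hκ : ∀ a v, 0 ≤ κ a v) (c : ℝ)
    (hDK : ∀ ε : ℝ, 0 < ε → ∀ᶠ a in l, ∀ u v : GridNode Ω (n a) ν,
      |((T.gridGraph Ω p (n a)).degMatrix + Matrix.diagonal (κ a)
        - (c • (1 : Matrix (GridNode Ω (n a) ν) (GridNode Ω (n a) ν) ℝ)) *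
          Matrix.diagonal (fun x : GridNode Ω (n a) ν => p (immersion (n a) x.1))) u v| ≤ ε) :
    IsEigDistributed l
      (fun a => ((T.gridGraph Ω p (n a)).laplacian (κ a)).map Complex.ofReal)
      (Ω ×ˢ Set.Icc (fun _ => -Real.pi) (fun _ => Real.pi) : Set ((Fin d → ℝ) × (Fin d → ℝ)))
      (fun y => (p y.1 : ℂ) • ((c : ℂ) • (1 : Matrix (Fin ν) (Fin ν) ℂ) - T.symbol y.2)) := by
  have hsymb : ∀ y : (Fin d → ℝ) × (Fin d → ℝ),
      (p y.1 : ℂ) • ((c : ℂ) • (1 : Matrix (Fin ν) (Fin ν) ℂ) - T.symbol y.2) =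
        (p y.1 : ℂ) • evalTrig y.2 (T.shiftedPoly c) := fun y => by
    rw [T.evalTrig_shiftedPoly]
  refine ⟨(tendsto_card_gridNode_atTop hΩ).comp hn, hΩ.nullMeasurableSet_prod_thetaBox, ?_,
    volume_prod_thetaBox_lt_top hΩ.volume_lt_top, fun i j => ?_,
    fun y _ => isHermitian_ofReal_smul (T.isHermitian_shifted_symbol c y.2) _, fun F hF hFc => ?_⟩
  · have h : 0 < volume.real (Ω ×ˢ thetaBox d) := by
      rw [volume_real_prod_thetaBox]
      exact mul_pos hΩ.volume_real_pos (by positivity)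
    exact (ENNReal.toReal_pos_iff.1 h).1
  · have hG : Continuous fun z : ℝ × (Fin d → ℝ) =>
        ((z.1 : ℂ) • evalTrig z.2 (T.shiftedPoly c)) i j :=
      ((Complex.continuous_ofReal.comp continuous_fst).smul
        ((continuous_evalTrig (T.shiftedPoly c)).comp continuous_snd)).matrix_elem i j
    simp only [hsymb]
    exact hG.measurable.comp_aemeasurable (aemeasurable_prodMk_snd (hΩ.aemeasurable hp))
  · simp only [hsymb]
    refine tendsto_mean_eigSum_laplacian T Ω hΩ p hp l n hn κ c (fun ε hε => ?_) hF hFc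
    filter_upwards [hDK ε hε] with a ha u
    -- Only diagonal entries carry information, as both matrices are diagonal.
    have h := ha u u
    rwa [Matrix.sub_apply, Matrix.add_apply, WeightedGraph.degMatrix, Matrix.diagonal_apply_eq,
      Matrix.diagonal_apply_eq, smul_mul_assoc, one_mul, Matrix.smul_apply,
      Matrix.diagonal_apply_eq, smul_eq_mul] at h
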